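/- Let all positive integers occur in four primary colors $A,B,C,D$, let the integers $\ge 2$ also occur in the six secondary colors $AB,AC,AD,BC,BD,CD$, and let the integers $\ge 4$ also occur in the quaternary color $ABCD$. Order the colored integers as follows: if $m<n$ as ordinary integers, then $m$ in any color precedes $n$ in any color; and for the same integer $n$ in different colors $$ABCD_n<AB_n<AC_n<AD_n<A_n<BC_n<BD_n<B_n<CD_n<C_n<D_n .$$ A Type-1 partition is a partition $m_1+m_2+\cdots$ into colored integers, written in decreasing order, such that (i) the parts in non-quaternary colors differ by at least $1$, with a difference equal to $1$ only if the two parts have the same primary color or the larger part has a color of strictly higher order (in the above order of colors); (ii) the parts in the quaternary color differ by at least $4$; (iii) every quaternary part is $\ge 3+2\tau$ if $A_1$ is a part, and $\ge 4+2\tau$ otherwise, where $\tau$ is the number of non-quaternary parts of the partition. For integers $a,b,c,d,ab,ac,ad,bc,bd,cd,Q\ge 0$ (the two-letter symbols are independent parameters, not products) let $\tilde G_6(n;a,b,c,d,ab,ac,ad,bc,bd,cd,Q)$ be the number of Type-1 partitions of $n$ with exactly $a,b,c,d,ab,ac,ad,bc,bd,cd,Q$ parts in the colors $A,B,C,D,AB,AC,AD,BC,BD,CD,ABCD$,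 respectively. For integers $i,j,k,l\ge 0$ put $$G_6(n;i,j,k,l)=\sum \tilde G_6(n;a,b,c,d,ab,ac,ad,bc,bd,cd,Q),$$ the sum being over all non-negative integers $a,b,c,d,ab,\dots,cd,Q$ with $$i=a+ab+ac+ad+Q,\quad j=b+ab+bc+bd+Q,\quad k=c+ac+bc+cd+Q,\quad l=d+ad+bd+cd+Q .$$ Let $P_6(n;i,j,k,l)$ be the number of partitions of $n$ into $i$ distinct parts in color $A$, $j$ distinct parts in color $B$, $k$ distinct parts in color $C$ and $l$ distinct parts in color $D$. Then for all integers $n,i,j,k,l\ge 0$ $$G_6(n;i,j,k,l)=P_6(n;i,j,k,l).$$ -/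

import Mathlib

namespace FourColor

/-- The eleven colors: four primary, six secondary and one quaternary. The constructors are listed
in increasing order. -/
inductive Color where
  | ABCD | AB | AC | AD | A | BC | BD | B | CD | C | D

namespace Color

/-- Position of a color in the order
`ABCD < AB < AC < AD < A < BC < BD < B < CD < C < D`. -/
def rank : Color → ℕ
  | ABCD => 0 | AB => 1 | AC => 2 | AD => 3 | A => 4 | BC => 5 | BD => 6 | B => 7 | CD => 8
  | C => 9 | D => 10

theorem rank_injective : Function.Injective rank := by
  intro x y h
  cases x <;> cases y <;> first | rfl | (exfalso; revert h; decide)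

instance : LinearOrder Color := LinearOrder.lift' rank rank_injective

instance : Fintype Color where
  elems := {ABCD, AB, AC, AD, A, BC, BD, B, CD, C, D}
  complete := by intro x; cases x <;> decide

/-- The primary colors `A`, `B`, `C`, `D`. -/
def IsPrimary (x : Color) : Prop := x = A ∨ x = B ∨ x = C ∨ x = D

instance : DecidablePred IsPrimary := fun x =>
  inferInstanceAs (Decidable (x = A ∨ x = B ∨ x = C ∨ x = D))

/-- The least integer that occurs in a given color: `1` for primary, `2` for secondary and `4` for
the quaternary color. -/
def minSize : Color → ℕ
  | ABCD => 4
  | AB | AC | AD | BC | BD | CD => 2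
  | A | B | C | D => 1

theorem minSize_pos (x : Color) : 0 < x.minSize := by cases x <;> decide

end Color

/-- A colored integer: the positive integer `size` occurring in the color `color`. -/
@[ext]
structure ColoredInt where
  color : Color
  size : ℕ
  minSize_le : color.minSize ≤ size

namespace ColoredInt

theorem size_pos (m : ColoredInt) : 0 < m.size := m.color.minSize_pos.trans_le m.minSize_le

theorem key_injective :
    Function.Injective (fun m : ColoredInt => (toLex (m.size, m.color) : ℕ ×ₗ Color)) := by
  intro x y h
  have h' : (x.size, x.color) = (y.size, y.color) := toLex.injective h
  exact ColoredInt.ext (Prod.ext_iff.1 h').2 (Prod.ext_iff.1 h').1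

/-- Colored integers are compared by size first and, for equal sizes, by color. -/
instance : LinearOrder ColoredInt :=
  LinearOrder.lift' (fun m : ColoredInt => (toLex (m.size, m.color) : ℕ ×ₗ Color)) key_injective

theorem finite_size_le (n : ℕ) : {m : ColoredInt | m.size ≤ n}.Finite := by
  have h : ((Set.Iic n) ×ˢ (Set.univ : Set Color)).Finite :=
    (Set.finite_Iic n).prod Set.finite_univ
  refine Set.Finite.of_finite_image (f := fun m : ColoredInt => (m.size, m.color))
    (h.subset ?_) ?_
  · rintro _ ⟨m, hm, rfl⟩
    exact ⟨hm, trivial⟩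
  · intro x _ y _ hxy
    exact ColoredInt.ext (Prod.ext_iff.1 hxy).2 (Prod.ext_iff.1 hxy).1

end ColoredInt

/-- A partition `m₁ + m₂ + ⋯ = n` of `n` into colored integers, the parts being listed in
(weakly) decreasing order. -/
@[ext]
structure ColoredPartition (n : ℕ) where
  parts : List ColoredInt
  sorted : parts.Pairwise (· ≥ ·)
  sum_eq : (parts.map ColoredInt.size).sum = n

namespace ColoredPartition

variable {n : ℕ}

/-- There are only finitely many colored partitions of `n`, so that the cardinalities below are
genuine counts. -/
instance : Finite (ColoredPartition n) := by
  have key : ∀ l : List ColoredInt, l.length ≤ (l.map ColoredInt.size).sum ∧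
      ∀ m ∈ l, m.size ≤ (l.map ColoredInt.size).sum := by
    intro l
    induction l with
    | nil => simp
    | cons x l ih =>
      have := x.size_pos
      simp only [List.length_cons, List.map_cons, List.sum_cons, List.mem_cons, forall_eq_or_imp]
      refine ⟨by omega, by omega, fun m hm => ?_⟩
      have := ih.2 m hm
      omega
  have : Finite {m : ColoredInt // m.size ≤ n} := (ColoredInt.finite_size_le n).to_subtype
  have hfin := List.finite_length_le {m : ColoredInt // m.size ≤ n} n
  have himg := hfin.image (List.map Subtype.val)
  have hparts : (Set.range (fun p : ColoredPartition n => p.parts)).Finite := by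
    refine himg.subset ?_
    rintro _ ⟨p, rfl⟩
    have hk := key p.parts
    rw [p.sum_eq] at hk
    refine ⟨p.parts.attach.map (fun m => ⟨m.1, hk.2 m.1 m.2⟩), by simpa using hk.1, ?_⟩
    simp [List.map_map, Function.comp_def]
  have : Finite (Set.range (fun p : ColoredPartition n => p.parts)) := hparts.to_subtype
  exact Finite.of_injective_finite_range (f := fun p : ColoredPartition n => p.parts)
    (fun p q h => ColoredPartition.ext h)

/-- The number of parts of `p` in the color `x`. -/
def count (p : ColoredPartition n) (x : Color) : ℕ := p.parts.countP (fun m => m.color = x)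

/-- The non-quaternary parts, in decreasing order. -/
def nonquaternary (p : ColoredPartition n) : List ColoredInt :=
  p.parts.filter (fun m => m.color ≠ Color.ABCD)

/-- The quaternary parts, in decreasing order. -/
def quaternary (p : ColoredPartition n) : List ColoredInt :=
  p.parts.filter (fun m => m.color = Color.ABCD)

/-- The number of non-quaternary parts. -/
def tau (p : ColoredPartition n) : ℕ := p.nonquaternary.length

end ColoredPartition

/-- The gap condition for a larger part `x` and a smaller part `y` in non-quaternary colors: the
gap is at least `1`, with equality only if the parts have the same primary color or the larger part
has a color of strictly higher order. -/
def GapCondition (x y : ColoredInt) : Prop :=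
  y.size + 1 ≤ x.size ∧
    (x.size = y.size + 1 →
      (x.color = y.color ∧ x.color.IsPrimary) ∨ y.color < x.color)

/-- The colored integer `1` in color `A`. -/
def A₁ : ColoredInt := ⟨Color.A, 1, le_refl _⟩

/-- Type-1 partitions. -/
structure IsTypeOne {n : ℕ} (p : ColoredPartition n) : Prop where
  /-- gaps among the non-quaternary parts -/
  gap : p.nonquaternary.Pairwise GapCondition
  /-- gaps among the quaternary parts -/
  gap_quaternary : p.quaternary.Pairwise (fun x y => y.size + 4 ≤ x.size)
  /-- the lower bound on the least quaternary part, equivalently on every quaternary part -/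
  lower : ∀ m ∈ p.quaternary,
    (if A₁ ∈ p.parts then 3 + 2 * p.tau else 4 + 2 * p.tau) ≤ m.size

/-- The number of Type-1 partitions of `n` with exactly `ν x` parts in each color `x`. -/
noncomputable def tildeG (n : ℕ) (ν : Color → ℕ) : ℕ :=
  Nat.card {p : ColoredPartition n // IsTypeOne p ∧ ∀ x, p.count x = ν x}

/-- The `i,j,k,l`-constraints on the numbers of parts in the eleven colors. -/
def Constraints (i j k l : ℕ) (ν : Color → ℕ) : Prop :=
  i = ν .A + ν .AB + ν .AC + ν .AD + ν .ABCD ∧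
  j = ν .B + ν .AB + ν .BC + ν .BD + ν .ABCD ∧
  k = ν .C + ν .AC + ν .BC + ν .CD + ν .ABCD ∧
  l = ν .D + ν .AD + ν .BD + ν .CD + ν .ABCD

theorem constraints_finite (i j k l : ℕ) : {ν | Constraints i j k l ν}.Finite := by
  refine (Set.finite_Iic (fun _ : Color => i + j + k + l)).subset ?_
  rintro ν ⟨h1, h2, h3, h4⟩ x
  cases x <;> dsimp only <;> omega

/-- The number of Type-1 partitions of `n` whose color counts satisfy the `i,j,k,l`-constraints,
as the sum of `tildeG` over all color counts that satisfy them. -/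
noncomputable def G (n i j k l : ℕ) : ℕ :=
  ∑ ν ∈ (constraints_finite i j k l).toFinset, tildeG n ν

/-- The number of partitions of `n` into `i` distinct parts in color `A`, `j` distinct parts in
color `B`, `k` distinct parts in color `C` and `l` distinct parts in color `D`. -/
noncomputable def P (n i j k l : ℕ) : ℕ :=
  Nat.card {p : ColoredPartition n // p.parts.Nodup ∧ (∀ m ∈ p.parts, m.color.IsPrimary) ∧
    p.count .A = i ∧ p.count .B = j ∧ p.count .C = k ∧ p.count .D = l}

end FourColor

/-! ### Multisums over color counts and their contiguous relations. -/

namespace FourColor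

open Finset

/-! Both sides are compared through generating functions in q. Partitions into i distinct parts of
one color have generating function q^(i(i+1)/2) / (q;q)_i, so the count `P` is a coefficient of a
product of four such factors (`P_eq`).

For fixed color counts ν the Type-1 partitions also have a closed form (`gf_typeOneParts`). The
non-quaternary parts are built from the smallest upwards. The colors allowed at gap 1 form an upper
segment of the color order, so the contributions of the possible smallest parts telescope, and the
recursion is solved by a power of q times the product of the 1 / (q;q)_(ν x) (`gf_chains`). The
quaternary parts have gaps 4 above a bound that depends only on τ and on the presence of `A₁`, hence
they contribute an independent factor.

What remains is a q-multisum identity: the sum of these closed forms over all ν with prescribed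
letter counts is the product. The signed sum is first rewritten as the six-term `fullSum`
(`typeOne_sum_eq`). Writing F(i,j,k,l) for it, (1 - q^i) F(i,j,k,l) = q^i F(i-1,j,k,l) for i ≥ 1,
which is the recursion of the product in i. For i = 0 only two of the six sums survive, and they
satisfy the analogous recursion in j; for j = 0 one sum is left, with recursions in k and then l;
the last value is 1 (`fullSum_eq`).

The recursions `recursion_A` to `recursion_D` are explicit linear combinations of instances of one
relation, `colorSum_contiguous`, together with the vanishing of sums that use an absent letter;
`colorSum_constraint` then brings in the factors q^i, q^j, q^k, q^l. -/

theorem Color.sum_univ {M : Type*} [AddCommMonoid M] (f : Color → M) :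
    ∑ x, f x = f .ABCD + f .AB + f .AC + f .AD + f .A + f .BC + f .BD + f .B + f .CD + f .C
      + f .D := by
  have h : (univ : Finset Color) = {.ABCD, .AB, .AC, .AD, .A, .BC, .BD, .B, .CD, .C, .D} := rfl
  rw [h]
  repeat rw [sum_insert (by decide)]
  rw [sum_singleton]
  simp only [add_assoc]

/-- The number of occurrences of the letter `x` (`A`, `B`, `C`, `D` for `0`, `1`, `2`, `3`) in a
color. -/
def Color.letters : Color → Fin 4 → ℕ
  | .ABCD => ![1, 1, 1, 1] | .AB => ![1, 1, 0, 0] | .AC => ![1, 0, 1, 0] | .AD => ![1, 0, 0, 1]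
  | .A => ![1, 0, 0, 0] | .BC => ![0, 1, 1, 0] | .BD => ![0, 1, 0, 1] | .B => ![0, 1, 0, 0]
  | .CD => ![0, 0, 1, 1] | .C => ![0, 0, 1, 0] | .D => ![0, 0, 0, 1]

theorem Color.exists_letter (x : Color) : ∃ t, x.letters t = 1 := by
  cases x <;> decide

/-- Color counts whose letter counts, increased by `u`, are equal to `v`. -/
def letterSet (v u : Fin 4 → ℕ) : Set (Color → ℕ) :=
  {ν | ∀ t, ∑ x, ν x * x.letters t + u t = v t}

theorem letterSet_finite (v u : Fin 4 → ℕ) : (letterSet v u).Finite := by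
  refine (Set.finite_Iic (fun _ : Color => ∑ t, v t)).subset ?_
  intro ν hν x
  obtain ⟨t, ht⟩ := x.exists_letter
  calc ν x = ν x * x.letters t := by rw [ht, mul_one]
    _ ≤ ∑ y, ν y * y.letters t :=
        single_le_sum (f := fun y : Color => ν y * y.letters t) (fun _ _ => Nat.zero_le _)
          (mem_univ x)
    _ ≤ v t := by have := hν t; omega
    _ ≤ ∑ t, v t := single_le_sum (f := v) (fun _ _ => Nat.zero_le _) (mem_univ t)

/-- The color counts in `letterSet v u` as a finite set. -/
noncomputable def letterFinset (v u : Fin 4 → ℕ) : Finset (Color → ℕ) :=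
  (letterSet_finite v u).toFinset

theorem mem_letterFinset {v u : Fin 4 → ℕ} {ν : Color → ℕ} :
    ν ∈ letterFinset v u ↔ ∀ t, ∑ x, ν x * x.letters t + u t = v t := by
  simp [letterFinset, letterSet]

/-- The number of non-quaternary parts plus twice the number of quaternary parts. -/
def weightedLength (ν : Color → ℕ) : ℕ :=
  ν .AB + ν .AC + ν .AD + ν .A + ν .BC + ν .BD + ν .B + ν .CD + ν .C + ν .D + 2 * ν .ABCD

/-- The quadratic exponent of the generating functions below. -/
def quadExp (ν : Color → ℕ) : ℕ :=
  (weightedLength ν + 1).choose 2 + ((ν .AB).choose 2 + (ν .AC).choose 2 + (ν .AD).choose 2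
    + (ν .BC).choose 2 + (ν .BD).choose 2 + (ν .CD).choose 2)

/-- The linear part of the increment of `quadExp` when the count of a color is increased. -/
def stepForm : Color → Color → ℕ
  | .ABCD, .ABCD => 4
  | .ABCD, _ => 2
  | _, .ABCD => 2
  | .AB, .AB => 2 | .AC, .AC => 2 | .AD, .AD => 2 | .BC, .BC => 2 | .BD, .BD => 2 | .CD, .CD => 2
  | _, _ => 1

/-- The constant part of the increment of `quadExp` when the count of a color is increased. -/
def stepConst : Color → ℕ
  | .ABCD => 3
  | _ => 1

theorem weightedLength_add_single (ν : Color → ℕ) (c : Color) :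
    weightedLength (ν + Pi.single c 1) = weightedLength ν + if c = .ABCD then 2 else 1 := by
  unfold weightedLength
  cases c <;> simp <;> omega

/-- With N the weighted length, raising N by 1 adds N + 1 to the triangular number and raising it by
2 adds 2N + 3. As N counts quaternary parts twice, this yields the coefficients 1, 2, 4 and the
constants 1, 3; a secondary color gets one more ν c from its own binomial. -/
theorem quadExp_add_single (ν : Color → ℕ) (c : Color) :
    quadExp (ν + Pi.single c 1) = quadExp ν + ∑ x, stepForm c x * ν x + stepConst c := by
  have h1 : ∀ n : ℕ, (n + 1).choose 2 = n + n.choose 2 := fun n => by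
    rw [Nat.choose_succ_succ' n 1, Nat.choose_one_right]
  rw [Color.sum_univ, quadExp, weightedLength_add_single, quadExp]
  have hN : weightedLength ν = ν .AB + ν .AC + ν .AD + ν .A + ν .BC + ν .BD + ν .B + ν .CD + ν .C
    + ν .D + 2 * ν .ABCD := rfl
  generalize weightedLength ν = N at hN ⊢
  cases c <;> simp only [Pi.add_apply, Pi.single_apply, reduceCtorEq, if_true, if_false, add_zero,
    stepForm, stepConst, h1] <;> omega

section Sum

variable {R : Type*} [CommRing R] (q : R) (w : ℕ → R)

/-- The sum over all color counts with letter counts `v - u` of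
`q ^ (quadExp ν + L ν) * ∏ x, w (ν x)`, where `w n` stands for `1 / (q; q)_n`. -/
noncomputable def colorSum (v : Fin 4 → ℕ) (L : Color → ℕ) (u : Fin 4 → ℕ) : R :=
  ∑ ν ∈ letterFinset v u, q ^ (quadExp ν + ∑ x, L x * ν x) * ∏ x, w (ν x)

variable {q w}

/-- The difference of the two sums with equal `u` carries the factor 1 - q^(ν c), which turns `w (ν
c)` into `w (ν c - 1)`. Replacing ν by ν plus one part of color c then gives the last sum, the
change of `quadExp` being affine in ν. -/
theorem colorSum_contiguous (hw : ∀ n, w n = (1 - q ^ (n + 1)) * w (n + 1)) (v : Fin 4 → ℕ)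
    (L : Color → ℕ) (u : Fin 4 → ℕ) (c : Color) :
    colorSum q w v L u = colorSum q w v (L + Pi.single c 1) u
      + q ^ (L c + stepConst c) * colorSum q w v (L + stepForm c) (u + c.letters) := by
  rw [← sub_eq_iff_eq_add']
  unfold colorSum
  rw [← sum_sub_distrib, mul_sum]
  have hsub : ∀ ν : Color → ℕ, q ^ (quadExp ν + ∑ x, L x * ν x) * ∏ x, w (ν x)
      - q ^ (quadExp ν + ∑ x, (L + Pi.single c 1 : Color → ℕ) x * ν x) * ∏ x, w (ν x)
      = q ^ (quadExp ν + ∑ x, L x * ν x) * ((1 - q ^ ν c) * ∏ x, w (ν x)) := by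
    intro ν
    have : ∑ x, (L + Pi.single c 1 : Color → ℕ) x * ν x = ∑ x, L x * ν x + ν c := by
      simp [add_mul, sum_add_distrib, Pi.single_apply]
    rw [this]
    ring
  rw [sum_congr rfl fun ν _ => hsub ν]
  -- Terms with ν c = 0 carry the factor 1 - q^0 = 0; discarding them makes the truncated
  -- subtraction of a part of color c reversible.
  rw [← sum_filter_of_ne (p := fun ν => ν c ≠ 0)]
  swap
  · intro ν _ h h0
    apply h
    simp [h0]
  symm
  refine sum_nbij' (fun ν => ν + Pi.single c 1) (fun ν => ν - Pi.single c 1) ?_ ?_ ?_ ?_ ?_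
  · intro ν hν
    rw [mem_letterFinset] at hν
    rw [mem_filter, mem_letterFinset]
    refine ⟨fun t => ?_, by simp⟩
    rw [← hν t]
    simp [add_mul, sum_add_distrib, Pi.single_apply]
    ring
  · intro ν hν
    rw [mem_filter, mem_letterFinset] at hν
    rw [mem_letterFinset]
    intro t
    have h1 : ν = (ν - Pi.single c 1) + Pi.single c 1 := by
      ext x
      by_cases hx : x = c
      · subst hx; have := hν.2; simp; omega
      · simp [hx]
    have h2 := hν.1 t
    rw [h1] at h2
    simp only [Pi.add_apply, add_mul, sum_add_distrib, Pi.single_apply, ite_mul, one_mul, zero_mul,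
      sum_ite_eq', mem_univ, if_true] at h2
    rw [Pi.add_apply, ← h2]
    simp only [Pi.sub_apply, Pi.single_apply]
    ring
  · intro ν _
    ext x
    simp
  · intro ν hν
    ext x
    by_cases hx : x = c
    · subst hx; have := (mem_filter.1 hν).2; simp; omega
    · simp [hx]
  · intro ν _
    have hprod : ∏ x, w (ν x)
        = (1 - q ^ (ν + Pi.single c 1 : Color → ℕ) c) * ∏ x, w ((ν + Pi.single c 1 : Color → ℕ)
            x) := by
      rw [← mul_prod_erase univ _ (mem_univ c), ← mul_prod_erase univ (fun x => w _) (mem_univ c),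
        ← mul_assoc]
      congr 1
      · simpa using hw (ν c)
      · refine prod_congr rfl fun x hx => ?_
        simp [ne_of_mem_erase hx]
    have hexp : ∑ x, L x * (ν + Pi.single c 1 : Color → ℕ) x = ∑ x, L x * ν x + L c := by
      simp [mul_add, sum_add_distrib, Pi.single_apply]
    have hexp' : ∑ x, (L + stepForm c : Color → ℕ) x * ν x = ∑ x, L x * ν x + ∑ x, stepForm c x
        * ν x := by
      simp [add_mul, sum_add_distrib]
    rw [← hprod, quadExp_add_single, hexp, hexp']
    ring

/-- On the range of summation the number of letters t is exactly v t - u t, so adding that linear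
form to the exponent only multiplies by a constant power of q. -/
theorem colorSum_constraint (v : Fin 4 → ℕ) (L : Color → ℕ) (u : Fin 4 → ℕ) (t : Fin 4) :
    q ^ u t * colorSum q w v (L + fun x => Color.letters x t) u = q ^ v t * colorSum q w v L u := by
  unfold colorSum
  rw [mul_sum, mul_sum]
  refine sum_congr rfl fun ν hν => ?_
  rw [← mem_letterFinset.1 hν t]
  have : ∑ x, (L + fun x => Color.letters x t) x * ν x
      = ∑ x, L x * ν x + ∑ x, ν x * x.letters t := by
    rw [← sum_add_distrib]
    exact sum_congr rfl fun x _ => by simp only [Pi.add_apply]; ring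
  rw [this]
  ring

theorem colorSum_eq_zero {v : Fin 4 → ℕ} (L : Color → ℕ) {u : Fin 4 → ℕ} {t : Fin 4}
    (h : v t < u t) : colorSum q w v L u = 0 := by
  unfold colorSum
  have : letterFinset v u = ∅ := by
    rw [eq_empty_iff_forall_notMem]
    intro ν hν
    have := mem_letterFinset.1 hν t
    omega
  rw [this, sum_empty]

theorem colorSum_shift {v v' : Fin 4 → ℕ} (L : Color → ℕ) {u u' : Fin 4 → ℕ}
    (h : v + u' = v' + u) : colorSum q w v L u = colorSum q w v' L u' := by
  unfold colorSum
  have : letterFinset v u = letterFinset v' u' := by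
    ext ν
    rw [mem_letterFinset, mem_letterFinset]
    refine forall_congr' fun t => ?_
    have := congrFun h t
    simp only [Pi.add_apply] at this
    omega
  rw [this]

end Sum

end FourColor

/-! ### Contiguous relations with explicit coefficients, one for each color. -/

namespace FourColor

open Finset

/-- The linear form with the given coefficients. -/
def colorVec (a b c d ab ac ad bc bd cd e : ℕ) : Color → ℕ
  | .A => a | .B => b | .C => c | .D => d | .AB => ab | .AC => ac | .AD => ad | .BC => bc
  | .BD => bd | .CD => cd | .ABCD => e

section Certificates

variable {R : Type*} [CommRing R] (q : R) (w : ℕ → R) (v : Fin 4 → ℕ)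

/-- `colorSum` with explicit coefficients. -/
noncomputable def litSum (a b c d ab ac ad bc bd cd e u₁ u₂ u₃ u₄ : ℕ) : R :=
  colorSum q w v (colorVec a b c d ab ac ad bc bd cd e) ![u₁, u₂, u₃, u₄]

variable {q w}

/-- This relation and its ten analogues specialize `colorSum_contiguous` with every coefficient as a
separate argument. Once numerals are reduced, equal sums become syntactically equal, and a
combination of relations can be checked by `ring` with the sums as atoms. -/
theorem contigA (hw : ∀ n, w n = (1 - q ^ (n + 1)) * w (n + 1))
    (a b c d ab ac ad bc bd cd e u₁ u₂ u₃ u₄ : ℕ) : litSum q w v a b c d ab ac ad bc bd cd e u₁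
        u₂ u₃ u₄
    = litSum q w v (a + 1) b c d ab ac ad bc bd cd e u₁ u₂ u₃ u₄
      + q ^ (a + 1) * litSum q w v (a + 1) (b + 1) (c + 1) (d + 1) (ab + 1) (ac + 1) (ad + 1)
          (bc + 1) (bd + 1) (cd + 1) (e + 2)
        (u₁ + 1) u₂ u₃ u₄ := by
  have h := colorSum_contiguous hw v (colorVec a b c d ab ac ad bc bd cd e) ![u₁, u₂, u₃, u₄] .A
  have h1 : colorVec a b c d ab ac ad bc bd cd e + Pi.single .A 1 = colorVec (a + 1) b c d ab ac
      ad bc bd cd e := by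
    funext x; cases x <;> rfl
  have h2 : colorVec a b c d ab ac ad bc bd cd e + stepForm .A
      = colorVec (a + 1) (b + 1) (c + 1) (d + 1) (ab + 1) (ac + 1) (ad + 1) (bc + 1) (bd + 1)
          (cd + 1) (e + 2) := by
    funext x; cases x <;> rfl
  have h3 : ![u₁, u₂, u₃, u₄] + Color.letters .A = ![u₁ + 1, u₂, u₃, u₄] := by
    funext x; fin_cases x <;> rfl
  rw [h1, h2, h3] at h
  exact h

theorem contigB (hw : ∀ n, w n = (1 - q ^ (n + 1)) * w (n + 1))
    (a b c d ab ac ad bc bd cd e u₁ u₂ u₃ u₄ : ℕ) : litSum q w v a b c d ab ac ad bc bd cd e u₁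
        u₂ u₃ u₄
    = litSum q w v a (b + 1) c d ab ac ad bc bd cd e u₁ u₂ u₃ u₄
      + q ^ (b + 1) * litSum q w v (a + 1) (b + 1) (c + 1) (d + 1) (ab + 1) (ac + 1) (ad + 1)
          (bc + 1) (bd + 1) (cd + 1) (e + 2)
        u₁ (u₂ + 1) u₃ u₄ := by
  have h := colorSum_contiguous hw v (colorVec a b c d ab ac ad bc bd cd e) ![u₁, u₂, u₃, u₄] .B
  have h1 : colorVec a b c d ab ac ad bc bd cd e + Pi.single .B 1 = colorVec a (b + 1) c d ab ac
      ad bc bd cd e := by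
    funext x; cases x <;> rfl
  have h2 : colorVec a b c d ab ac ad bc bd cd e + stepForm .B
      = colorVec (a + 1) (b + 1) (c + 1) (d + 1) (ab + 1) (ac + 1) (ad + 1) (bc + 1) (bd + 1)
          (cd + 1) (e + 2) := by
    funext x; cases x <;> rfl
  have h3 : ![u₁, u₂, u₃, u₄] + Color.letters .B = ![u₁, u₂ + 1, u₃, u₄] := by
    funext x; fin_cases x <;> rfl
  rw [h1, h2, h3] at h
  exact h

theorem contigC (hw : ∀ n, w n = (1 - q ^ (n + 1)) * w (n + 1))
    (a b c d ab ac ad bc bd cd e u₁ u₂ u₃ u₄ : ℕ) : litSum q w v a b c d ab ac ad bc bd cd e u₁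
        u₂ u₃ u₄
    = litSum q w v a b (c + 1) d ab ac ad bc bd cd e u₁ u₂ u₃ u₄
      + q ^ (c + 1) * litSum q w v (a + 1) (b + 1) (c + 1) (d + 1) (ab + 1) (ac + 1) (ad + 1)
          (bc + 1) (bd + 1) (cd + 1) (e + 2)
        u₁ u₂ (u₃ + 1) u₄ := by
  have h := colorSum_contiguous hw v (colorVec a b c d ab ac ad bc bd cd e) ![u₁, u₂, u₃, u₄] .C
  have h1 : colorVec a b c d ab ac ad bc bd cd e + Pi.single .C 1 = colorVec a b (c + 1) d ab ac
      ad bc bd cd e := by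
    funext x; cases x <;> rfl
  have h2 : colorVec a b c d ab ac ad bc bd cd e + stepForm .C
      = colorVec (a + 1) (b + 1) (c + 1) (d + 1) (ab + 1) (ac + 1) (ad + 1) (bc + 1) (bd + 1)
          (cd + 1) (e + 2) := by
    funext x; cases x <;> rfl
  have h3 : ![u₁, u₂, u₃, u₄] + Color.letters .C = ![u₁, u₂, u₃ + 1, u₄] := by
    funext x; fin_cases x <;> rfl
  rw [h1, h2, h3] at h
  exact h

theorem contigD (hw : ∀ n, w n = (1 - q ^ (n + 1)) * w (n + 1))
    (a b c d ab ac ad bc bd cd e u₁ u₂ u₃ u₄ : ℕ) : litSum q w v a b c d ab ac ad bc bd cd e u₁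
        u₂ u₃ u₄
    = litSum q w v a b c (d + 1) ab ac ad bc bd cd e u₁ u₂ u₃ u₄
      + q ^ (d + 1) * litSum q w v (a + 1) (b + 1) (c + 1) (d + 1) (ab + 1) (ac + 1) (ad + 1)
          (bc + 1) (bd + 1) (cd + 1) (e + 2)
        u₁ u₂ u₃ (u₄ + 1) := by
  have h := colorSum_contiguous hw v (colorVec a b c d ab ac ad bc bd cd e) ![u₁, u₂, u₃, u₄] .D
  have h1 : colorVec a b c d ab ac ad bc bd cd e + Pi.single .D 1 = colorVec a b c (d + 1) ab ac
      ad bc bd cd e := by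
    funext x; cases x <;> rfl
  have h2 : colorVec a b c d ab ac ad bc bd cd e + stepForm .D
      = colorVec (a + 1) (b + 1) (c + 1) (d + 1) (ab + 1) (ac + 1) (ad + 1) (bc + 1) (bd + 1)
          (cd + 1) (e + 2) := by
    funext x; cases x <;> rfl
  have h3 : ![u₁, u₂, u₃, u₄] + Color.letters .D = ![u₁, u₂, u₃, u₄ + 1] := by
    funext x; fin_cases x <;> rfl
  rw [h1, h2, h3] at h
  exact h

theorem contigAB (hw : ∀ n, w n = (1 - q ^ (n + 1)) * w (n + 1))
    (a b c d ab ac ad bc bd cd e u₁ u₂ u₃ u₄ : ℕ) : litSum q w v a b c d ab ac ad bc bd cd e u₁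
        u₂ u₃ u₄
    = litSum q w v a b c d (ab + 1) ac ad bc bd cd e u₁ u₂ u₃ u₄
      + q ^ (ab + 1) * litSum q w v (a + 1) (b + 1) (c + 1) (d + 1) (ab + 2) (ac + 1) (ad + 1)
          (bc + 1) (bd + 1) (cd + 1) (e + 2)
        (u₁ + 1) (u₂ + 1) u₃ u₄ := by
  have h := colorSum_contiguous hw v (colorVec a b c d ab ac ad bc bd cd e) ![u₁, u₂, u₃, u₄] .AB
  have h1 : colorVec a b c d ab ac ad bc bd cd e + Pi.single .AB 1 = colorVec a b c d (ab + 1)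
      ac ad bc bd cd e := by
    funext x; cases x <;> rfl
  have h2 : colorVec a b c d ab ac ad bc bd cd e + stepForm .AB
      = colorVec (a + 1) (b + 1) (c + 1) (d + 1) (ab + 2) (ac + 1) (ad + 1) (bc + 1) (bd + 1)
          (cd + 1) (e + 2) := by
    funext x; cases x <;> rfl
  have h3 : ![u₁, u₂, u₃, u₄] + Color.letters .AB = ![u₁ + 1, u₂ + 1, u₃, u₄] := by
    funext x; fin_cases x <;> rfl
  rw [h1, h2, h3] at h
  exact h

theorem contigAC (hw : ∀ n, w n = (1 - q ^ (n + 1)) * w (n + 1))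
    (a b c d ab ac ad bc bd cd e u₁ u₂ u₃ u₄ : ℕ) : litSum q w v a b c d ab ac ad bc bd cd e u₁
        u₂ u₃ u₄
    = litSum q w v a b c d ab (ac + 1) ad bc bd cd e u₁ u₂ u₃ u₄
      + q ^ (ac + 1) * litSum q w v (a + 1) (b + 1) (c + 1) (d + 1) (ab + 1) (ac + 2) (ad + 1)
          (bc + 1) (bd + 1) (cd + 1) (e + 2)
        (u₁ + 1) u₂ (u₃ + 1) u₄ := by
  have h := colorSum_contiguous hw v (colorVec a b c d ab ac ad bc bd cd e) ![u₁, u₂, u₃, u₄] .AC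
  have h1 : colorVec a b c d ab ac ad bc bd cd e + Pi.single .AC 1 = colorVec a b c d ab (ac +
      1) ad bc bd cd e := by
    funext x; cases x <;> rfl
  have h2 : colorVec a b c d ab ac ad bc bd cd e + stepForm .AC
      = colorVec (a + 1) (b + 1) (c + 1) (d + 1) (ab + 1) (ac + 2) (ad + 1) (bc + 1) (bd + 1)
          (cd + 1) (e + 2) := by
    funext x; cases x <;> rfl
  have h3 : ![u₁, u₂, u₃, u₄] + Color.letters .AC = ![u₁ + 1, u₂, u₃ + 1, u₄] := by
    funext x; fin_cases x <;> rfl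
  rw [h1, h2, h3] at h
  exact h

theorem contigAD (hw : ∀ n, w n = (1 - q ^ (n + 1)) * w (n + 1))
    (a b c d ab ac ad bc bd cd e u₁ u₂ u₃ u₄ : ℕ) : litSum q w v a b c d ab ac ad bc bd cd e u₁
        u₂ u₃ u₄
    = litSum q w v a b c d ab ac (ad + 1) bc bd cd e u₁ u₂ u₃ u₄
      + q ^ (ad + 1) * litSum q w v (a + 1) (b + 1) (c + 1) (d + 1) (ab + 1) (ac + 1) (ad + 2)
          (bc + 1) (bd + 1) (cd + 1) (e + 2)
        (u₁ + 1) u₂ u₃ (u₄ + 1) := by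
  have h := colorSum_contiguous hw v (colorVec a b c d ab ac ad bc bd cd e) ![u₁, u₂, u₃, u₄] .AD
  have h1 : colorVec a b c d ab ac ad bc bd cd e + Pi.single .AD 1 = colorVec a b c d ab ac (ad
      + 1) bc bd cd e := by
    funext x; cases x <;> rfl
  have h2 : colorVec a b c d ab ac ad bc bd cd e + stepForm .AD
      = colorVec (a + 1) (b + 1) (c + 1) (d + 1) (ab + 1) (ac + 1) (ad + 2) (bc + 1) (bd + 1)
          (cd + 1) (e + 2) := by
    funext x; cases x <;> rfl
  have h3 : ![u₁, u₂, u₃, u₄] + Color.letters .AD = ![u₁ + 1, u₂, u₃, u₄ + 1] := by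
    funext x; fin_cases x <;> rfl
  rw [h1, h2, h3] at h
  exact h

theorem contigBC (hw : ∀ n, w n = (1 - q ^ (n + 1)) * w (n + 1))
    (a b c d ab ac ad bc bd cd e u₁ u₂ u₃ u₄ : ℕ) : litSum q w v a b c d ab ac ad bc bd cd e u₁
        u₂ u₃ u₄
    = litSum q w v a b c d ab ac ad (bc + 1) bd cd e u₁ u₂ u₃ u₄
      + q ^ (bc + 1) * litSum q w v (a + 1) (b + 1) (c + 1) (d + 1) (ab + 1) (ac + 1) (ad + 1)
          (bc + 2) (bd + 1) (cd + 1) (e + 2)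
        u₁ (u₂ + 1) (u₃ + 1) u₄ := by
  have h := colorSum_contiguous hw v (colorVec a b c d ab ac ad bc bd cd e) ![u₁, u₂, u₃, u₄] .BC
  have h1 : colorVec a b c d ab ac ad bc bd cd e + Pi.single .BC 1 = colorVec a b c d ab ac ad
      (bc + 1) bd cd e := by
    funext x; cases x <;> rfl
  have h2 : colorVec a b c d ab ac ad bc bd cd e + stepForm .BC
      = colorVec (a + 1) (b + 1) (c + 1) (d + 1) (ab + 1) (ac + 1) (ad + 1) (bc + 2) (bd + 1)
          (cd + 1) (e + 2) := by
    funext x; cases x <;> rfl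
  have h3 : ![u₁, u₂, u₃, u₄] + Color.letters .BC = ![u₁, u₂ + 1, u₃ + 1, u₄] := by
    funext x; fin_cases x <;> rfl
  rw [h1, h2, h3] at h
  exact h

theorem contigBD (hw : ∀ n, w n = (1 - q ^ (n + 1)) * w (n + 1))
    (a b c d ab ac ad bc bd cd e u₁ u₂ u₃ u₄ : ℕ) : litSum q w v a b c d ab ac ad bc bd cd e u₁
        u₂ u₃ u₄
    = litSum q w v a b c d ab ac ad bc (bd + 1) cd e u₁ u₂ u₃ u₄
      + q ^ (bd + 1) * litSum q w v (a + 1) (b + 1) (c + 1) (d + 1) (ab + 1) (ac + 1) (ad + 1)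
          (bc + 1) (bd + 2) (cd + 1) (e + 2)
        u₁ (u₂ + 1) u₃ (u₄ + 1) := by
  have h := colorSum_contiguous hw v (colorVec a b c d ab ac ad bc bd cd e) ![u₁, u₂, u₃, u₄] .BD
  have h1 : colorVec a b c d ab ac ad bc bd cd e + Pi.single .BD 1 = colorVec a b c d ab ac ad
      bc (bd + 1) cd e := by
    funext x; cases x <;> rfl
  have h2 : colorVec a b c d ab ac ad bc bd cd e + stepForm .BD
      = colorVec (a + 1) (b + 1) (c + 1) (d + 1) (ab + 1) (ac + 1) (ad + 1) (bc + 1) (bd + 2)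
          (cd + 1) (e + 2) := by
    funext x; cases x <;> rfl
  have h3 : ![u₁, u₂, u₃, u₄] + Color.letters .BD = ![u₁, u₂ + 1, u₃, u₄ + 1] := by
    funext x; fin_cases x <;> rfl
  rw [h1, h2, h3] at h
  exact h

theorem contigCD (hw : ∀ n, w n = (1 - q ^ (n + 1)) * w (n + 1))
    (a b c d ab ac ad bc bd cd e u₁ u₂ u₃ u₄ : ℕ) : litSum q w v a b c d ab ac ad bc bd cd e u₁
        u₂ u₃ u₄
    = litSum q w v a b c d ab ac ad bc bd (cd + 1) e u₁ u₂ u₃ u₄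
      + q ^ (cd + 1) * litSum q w v (a + 1) (b + 1) (c + 1) (d + 1) (ab + 1) (ac + 1) (ad + 1)
          (bc + 1) (bd + 1) (cd + 2) (e + 2)
        u₁ u₂ (u₃ + 1) (u₄ + 1) := by
  have h := colorSum_contiguous hw v (colorVec a b c d ab ac ad bc bd cd e) ![u₁, u₂, u₃, u₄] .CD
  have h1 : colorVec a b c d ab ac ad bc bd cd e + Pi.single .CD 1 = colorVec a b c d ab ac ad
      bc bd (cd + 1) e := by
    funext x; cases x <;> rfl
  have h2 : colorVec a b c d ab ac ad bc bd cd e + stepForm .CD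
      = colorVec (a + 1) (b + 1) (c + 1) (d + 1) (ab + 1) (ac + 1) (ad + 1) (bc + 1) (bd + 1)
          (cd + 2) (e + 2) := by
    funext x; cases x <;> rfl
  have h3 : ![u₁, u₂, u₃, u₄] + Color.letters .CD = ![u₁, u₂, u₃ + 1, u₄ + 1] := by
    funext x; fin_cases x <;> rfl
  rw [h1, h2, h3] at h
  exact h

theorem contigABCD (hw : ∀ n, w n = (1 - q ^ (n + 1)) * w (n + 1))
    (a b c d ab ac ad bc bd cd e u₁ u₂ u₃ u₄ : ℕ) : litSum q w v a b c d ab ac ad bc bd cd e u₁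
        u₂ u₃ u₄
    = litSum q w v a b c d ab ac ad bc bd cd (e + 1) u₁ u₂ u₃ u₄
      + q ^ (e + 3) * litSum q w v (a + 2) (b + 2) (c + 2) (d + 2) (ab + 2) (ac + 2) (ad + 2)
          (bc + 2) (bd + 2) (cd + 2) (e + 4)
        (u₁ + 1) (u₂ + 1) (u₃ + 1) (u₄ + 1) := by
  have h := colorSum_contiguous hw v (colorVec a b c d ab ac ad bc bd cd e) ![u₁, u₂, u₃, u₄] .ABCD
  have h1 : colorVec a b c d ab ac ad bc bd cd e + Pi.single .ABCD 1 = colorVec a b c d ab ac ad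
      bc bd cd (e + 1) := by
    funext x; cases x <;> rfl
  have h2 : colorVec a b c d ab ac ad bc bd cd e + stepForm .ABCD
      = colorVec (a + 2) (b + 2) (c + 2) (d + 2) (ab + 2) (ac + 2) (ad + 2) (bc + 2) (bd + 2)
          (cd + 2) (e + 4) := by
    funext x; cases x <;> rfl
  have h3 : ![u₁, u₂, u₃, u₄] + Color.letters .ABCD = ![u₁ + 1, u₂ + 1, u₃ + 1, u₄ + 1] := by
    funext x; fin_cases x <;> rfl
  rw [h1, h2, h3] at h
  exact h

end Certificates

end FourColor

/-! ### Certificates for the q-recursions. -/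

namespace FourColor

open Finset

section Recursions

variable {R : Type*} [CommRing R] (q : R) (w : ℕ → R) {v : Fin 4 → ℕ}

theorem litSum_eq_zero_A (h : v 0 = 0) (a b c d ab ac ad bc bd cd e u₁ u₂ u₃ u₄ : ℕ) :
    litSum q w v a b c d ab ac ad bc bd cd e (u₁ + 1) u₂ u₃ u₄ = 0 :=
  colorSum_eq_zero (t := 0) _ (by rw [h]; exact Nat.succ_pos _)

theorem litSum_eq_zero_B (h : v 1 = 0) (a b c d ab ac ad bc bd cd e u₁ u₂ u₃ u₄ : ℕ) :
    litSum q w v a b c d ab ac ad bc bd cd e u₁ (u₂ + 1) u₃ u₄ = 0 :=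
  colorSum_eq_zero (t := 1) _ (by rw [h]; exact Nat.succ_pos _)

theorem litSum_eq_zero_C (h : v 2 = 0) (a b c d ab ac ad bc bd cd e u₁ u₂ u₃ u₄ : ℕ) :
    litSum q w v a b c d ab ac ad bc bd cd e u₁ u₂ (u₃ + 1) u₄ = 0 :=
  colorSum_eq_zero (t := 2) _ (by rw [h]; exact Nat.succ_pos _)

variable {q w} (v)

local notation "S" => litSum q w v

/-- The five signed sums on the left are the terms of `gf_typeOneParts` expanded and summed over ν.
-/
theorem typeOne_sum_eq (hw : ∀ n, w n = (1 - q ^ (n + 1)) * w (n + 1)) :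
    S 0 0 0 0 1 1 1 0 0 0 0 0 0 0 0 - S 1 0 0 0 1 1 1 0 0 0 0 0 0 0 0 + S 1 0 0 0 1 1 1 1 1 0 1 0
      0 0 0 - S 1 1 0 0 1 1 1 1 1 0 1 0 0 0 0 + S 1 1 0 0 1 1 1 1 1 1 1 0 0 0 0
      = S 0 0 0 0 1 1 1 1 1 1 1 0 0 0 0 + q ^ 3 * S 2 2 2 2 3 3 3 3 2 2 4 1 1 1 0 + q ^ 3 * S 2 2
        2 2 3 3 3 3 3 2 4 1 1 0 1 + q ^ 3 * S 2 2 2 2 3 3 3 3 3 3 4 1 0 1 1 + q ^ 3 * S 3 2 2 2 3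
        3 3 3 3 3 5 0 1 1 1 + q ^ 6 * S 3 3 3 3 4 4 4 4 4 4 6 2 1 1 1 := by
  -- The certificate is an explicit combination of contiguous relations. Normalization is postponed
  -- so that the indices can first be reduced to numerals, which identifies equal sums.
  linear_combination (norm := skip)
    contigA v hw 0 0 0 0 1 1 1 0 0 0 0 0 0 0 0 + contigB v hw 1 0 0 0 1 1 1 1 1 0 1 0 0 0 0 -
      contigB v hw 1 0 0 0 1 1 1 1 1 1 1 0 0 0 0 - contigA v hw 0 0 0 0 1 1 1 1 1 1 1 0 0 0 0 + q
      * contigCD v hw 2 1 1 1 2 2 2 2 2 1 3 0 1 0 0 + q * contigBC v hw 1 1 1 1 2 2 2 1 1 1 2 1 0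
      0 0 + q * contigBD v hw 1 1 1 1 2 2 2 2 1 1 2 1 0 0 0 + q * contigCD v hw 1 1 1 1 2 2 2 2 2
      1 2 1 0 0 0 + q * contigABCD v hw 1 1 1 1 2 2 2 2 2 2 2 1 0 0 0
  simp only [Nat.reduceAdd]
  ring

/-- The right side is built for `litSum_constraint_A`: each summand of `fullSum` appears with the
form of the letter A added to its exponent and a factor q^u₁, then again with u₁ raised by one.
These two groups are q^(v 0) times `fullSum` at v and, if v 0 > 0, q^(v 0) times `fullSum` with one
letter A fewer. -/
theorem recursion_A (hw : ∀ n, w n = (1 - q ^ (n + 1)) * w (n + 1)) :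
    S 0 0 0 0 1 1 1 1 1 1 1 0 0 0 0 + q ^ 3 * S 2 2 2 2 3 3 3 3 2 2 4 1 1 1 0 + q ^ 3 * S 2 2 2 2
      3 3 3 3 3 2 4 1 1 0 1 + q ^ 3 * S 2 2 2 2 3 3 3 3 3 3 4 1 0 1 1 + q ^ 3 * S 3 2 2 2 3 3 3 3
      3 3 5 0 1 1 1 + q ^ 6 * S 3 3 3 3 4 4 4 4 4 4 6 2 1 1 1
      = S 1 0 0 0 2 2 2 1 1 1 2 0 0 0 0 + q ^ 4 * S 3 2 2 2 4 4 4 3 2 2 5 1 1 1 0 + q ^ 4 * S 3 2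
        2 2 4 4 4 3 3 2 5 1 1 0 1 + q ^ 4 * S 3 2 2 2 4 4 4 3 3 3 5 1 0 1 1 + q ^ 3 * S 4 2 2 2 4
        4 4 3 3 3 6 0 1 1 1 + q ^ 8 * S 4 3 3 3 5 5 5 4 4 4 7 2 1 1 1 + q * S 1 0 0 0 2 2 2 1 1 1
        2 1 0 0 0 + q ^ 5 * S 3 2 2 2 4 4 4 3 2 2 5 2 1 1 0 + q ^ 5 * S 3 2 2 2 4 4 4 3 3 2 5 2 1
        0 1 + q ^ 5 * S 3 2 2 2 4 4 4 3 3 3 5 2 0 1 1 + q ^ 4 * S 4 2 2 2 4 4 4 3 3 3 6 1 1 1 1 +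
        q ^ 9 * S 4 3 3 3 5 5 5 4 4 4 7 3 1 1 1 := by
  linear_combination (norm := skip)
    contigA v hw 0 0 0 0 1 1 1 1 1 1 1 0 0 0 0 + contigAB v hw 1 0 0 0 1 1 1 1 1 1 1 0 0 0 0 +
      contigAC v hw 1 0 0 0 2 1 1 1 1 1 1 0 0 0 0 + contigAD v hw 1 0 0 0 2 2 1 1 1 1 1 0 0 0 0 +
      contigABCD v hw 1 0 0 0 2 2 2 1 1 1 1 0 0 0 0 - q * contigCD v hw 1 1 1 1 2 2 2 2 2 1 3 1 0
      0 0 - q * contigABCD v hw 1 1 1 1 2 2 2 2 2 1 2 1 0 0 0 - q * contigBD v hw 1 1 1 1 2 2 2 2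
      1 1 2 1 0 0 0 - q * contigBC v hw 1 1 1 1 2 2 2 1 1 1 2 1 0 0 0 - q * contigD v hw 1 1 1 0 2
      2 2 1 1 1 2 1 0 0 0 - q * contigB v hw 1 0 1 0 2 2 2 1 1 1 2 1 0 0 0 - q * contigC v hw 1 0
      0 0 2 2 2 1 1 1 2 1 0 0 0 + q ^ 2 * contigB v hw 2 1 1 1 3 3 3 2 2 2 3 1 0 0 1 + q ^ 2 *
      contigC v hw 2 2 1 1 3 3 3 2 2 2 3 1 0 0 1 + q ^ 2 * contigABCD v hw 2 2 2 1 3 3 3 2 2 2 3 1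
      0 0 1 + q ^ 2 * contigAD v hw 2 1 1 1 3 3 2 2 2 2 3 1 0 1 0 + q ^ 2 * contigABCD v hw 2 1 1
      1 3 3 3 2 2 2 3 1 0 1 0 + q ^ 2 * contigC v hw 2 1 1 1 3 2 2 2 2 2 3 1 1 0 0 + q ^ 2 *
      contigAC v hw 2 1 2 1 3 2 2 2 2 2 3 1 1 0 0 + q ^ 2 * contigAD v hw 2 1 2 1 3 3 2 2 2 2 3 1
      1 0 0 + q ^ 2 * contigABCD v hw 2 1 2 1 3 3 3 2 2 2 3 1 1 0 0 + q ^ 3 * contigAC v hw 3 2 2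
      2 3 3 3 3 3 3 5 0 1 1 1 + q ^ 3 * contigAD v hw 3 2 2 2 3 4 3 3 3 3 5 0 1 1 1 + q ^ 3 *
      contigAB v hw 3 2 2 2 3 4 4 3 3 3 5 0 1 1 1 + q ^ 3 * contigA v hw 3 2 2 2 4 4 4 3 3 3 5 0 1
      1 1 + q ^ 3 * contigABCD v hw 4 2 2 2 4 4 4 3 3 3 5 0 1 1 1 + q ^ 3 * contigABCD v hw 2 2 2
      2 3 3 3 3 3 3 4 1 0 1 1 - q ^ 4 * contigB v hw 3 2 2 2 4 4 4 3 3 3 5 1 0 1 1 - q ^ 4 *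
      contigCD v hw 3 2 2 2 4 4 4 3 3 2 5 1 1 0 1 + q ^ 4 * contigAC v hw 3 2 2 2 4 3 3 3 3 3 5 1
      1 1 0 + q ^ 4 * contigAD v hw 3 2 2 2 4 4 3 3 3 3 5 1 1 1 0 - q ^ 4 * contigBD v hw 3 2 2 2
      4 4 4 3 2 3 5 1 1 1 0 - q ^ 4 * contigCD v hw 3 2 2 2 4 4 4 3 2 2 5 1 1 1 0 + q ^ 4 *
      contigA v hw 3 2 2 2 4 4 4 3 3 3 5 1 1 1 1 + q ^ 4 * contigABCD v hw 4 2 2 2 4 4 4 3 3 3 5 1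
      1 1 1 - q ^ 5 * contigCD v hw 3 2 3 2 4 4 4 3 3 2 5 2 1 0 1 - q ^ 5 * contigC v hw 3 2 2 2 4
      4 4 3 3 2 5 2 1 0 1 - q ^ 5 * contigC v hw 3 2 2 2 4 4 3 3 3 3 5 2 1 1 0 + q ^ 5 * contigAD
      v hw 3 2 2 2 4 4 3 3 3 3 5 2 1 1 0 - q ^ 5 * contigBD v hw 3 2 2 2 4 4 4 3 2 3 5 2 1 1 0 - q
      ^ 5 * contigCD v hw 3 2 2 2 4 4 4 3 2 2 5 2 1 1 0 + q ^ 7 * contigAB v hw 4 3 3 3 4 5 5 4 4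
      4 7 1 1 1 2 + q ^ 7 * contigAB v hw 4 3 3 3 4 5 4 4 4 4 7 1 1 2 1 + q ^ 7 * contigAD v hw 4
      3 3 3 5 5 4 4 4 4 7 1 1 2 1 - q ^ 7 * contigBD v hw 4 3 3 3 5 5 5 4 3 4 7 1 1 2 1 - q ^ 6 *
      contigCD v hw 3 3 3 3 4 4 4 4 4 3 6 2 1 1 1 - q ^ 8 * contigCD v hw 4 3 3 3 5 5 5 4 4 3 7 2
      1 1 1 - q ^ 8 * contigB v hw 4 3 4 3 5 5 5 4 4 4 7 2 1 1 2 - q ^ 8 * contigBD v hw 4 3 3 3 5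
      5 5 4 3 4 7 2 1 2 1 - q ^ 8 * contigC v hw 4 3 3 3 5 5 5 4 4 4 7 2 2 1 1 - q ^ 11 * contigA
      v hw 5 4 4 4 6 6 6 5 5 5 9 1 2 2 2 + q ^ 12 * contigC v hw 5 4 4 4 6 6 6 5 5 5 9 2 2 1 2 + q
      ^ 12 * contigAD v hw 5 4 4 4 6 6 5 5 5 5 9 2 2 2 1 - q ^ 12 * contigA v hw 5 4 4 4 6 6 6 5 5
      5 9 2 2 2 2
  simp only [Nat.reduceAdd]
  ring

/-- Same pattern as for A, now for the letter B and the two sums that survive without A. The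
multiples of `z0` remove the sums that would use up a letter A. -/
theorem recursion_B (hw : ∀ n, w n = (1 - q ^ (n + 1)) * w (n + 1)) (h0 : v 0 = 0) :
    S 0 0 0 0 1 1 1 1 1 1 1 0 0 0 0 + q ^ 3 * S 3 2 2 2 3 3 3 3 3 3 5 0 1 1 1
      = S 0 1 0 0 2 1 1 2 2 1 2 0 0 0 0 + q ^ 4 * S 3 3 2 2 4 3 3 4 4 3 6 0 1 1 1 + q * S 0 1 0 0
        2 1 1 2 2 1 2 0 1 0 0 + q ^ 5 * S 3 3 2 2 4 3 3 4 4 3 6 0 2 1 1 := by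
  have z0 := litSum_eq_zero_A q w h0
  linear_combination (norm := skip)
    contigB v hw 0 0 0 0 1 1 1 1 1 1 1 0 0 0 0 + contigAB v hw 0 1 0 0 1 1 1 1 1 1 1 0 0 0 0 + q ^
      2 * z0 1 2 1 1 3 2 2 2 2 2 3 0 1 0 0 + contigABCD v hw 0 1 0 0 2 1 1 1 1 1 1 0 0 0 0 + q ^ 4
      * z0 2 3 2 2 4 3 3 3 3 3 5 0 1 1 1 + contigBC v hw 0 1 0 0 2 1 1 1 1 1 2 0 0 0 0 + contigBD
      v hw 0 1 0 0 2 1 1 2 1 1 2 0 0 0 0 - q * contigCD v hw 1 1 1 1 2 2 2 2 2 1 3 0 1 0 0 - q *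
      contigABCD v hw 1 1 1 1 2 2 2 2 2 1 2 0 1 0 0 - q ^ 6 * z0 3 3 3 3 4 4 4 4 4 3 6 0 2 1 1 - q
      * contigA v hw 0 1 1 1 2 2 2 2 2 1 2 0 1 0 0 - q ^ 2 * z0 1 2 2 2 3 3 3 3 3 2 4 0 1 0 0 - q
      * contigAC v hw 0 1 1 1 2 1 2 2 2 1 2 0 1 0 0 - q ^ 3 * z0 1 2 2 2 3 3 3 3 3 2 4 0 1 1 0 - q
      * contigD v hw 0 1 1 0 2 1 2 2 2 1 2 0 1 0 0 - q * contigAD v hw 0 1 1 0 2 1 1 2 2 1 2 0 1 0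
      0 - q ^ 3 * z0 1 2 2 1 3 2 3 3 3 2 4 0 1 0 1 - q * contigC v hw 0 1 0 0 2 1 1 2 2 1 2 0 1 0
      0 + q ^ 2 * contigAD v hw 1 2 1 1 3 2 2 3 3 2 4 0 1 0 1 + q ^ 5 * z0 2 3 2 2 4 3 4 4 4 3 6 0
      1 0 2 + q ^ 2 * contigC v hw 1 2 1 1 3 2 3 3 3 2 4 0 1 0 1 + q ^ 2 * contigBD v hw 1 2 1 1 3
      2 2 3 2 2 4 0 1 1 0 - q ^ 3 * contigA v hw 2 2 2 2 3 3 3 3 3 3 5 0 1 1 1 - q ^ 6 * z0 3 3 3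
      3 4 4 4 4 4 4 7 0 1 1 1 - q ^ 4 * contigAD v hw 2 3 2 2 4 3 3 4 4 3 6 0 1 1 1 - q ^ 8 * z0 3
      4 3 3 5 4 5 5 5 4 8 0 1 1 2 + q ^ 4 * contigA v hw 2 3 2 2 4 3 3 4 4 3 6 0 1 1 1 + q ^ 7 *
      z0 3 4 3 3 5 4 4 5 5 4 8 0 1 1 1 + q ^ 5 * contigA v hw 2 3 2 2 4 3 3 4 4 3 6 0 2 1 1 + q ^
      8 * z0 3 4 3 3 5 4 4 5 5 4 8 0 2 1 1
  simp only [Nat.reduceAdd]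
  ring

theorem recursion_C (hw : ∀ n, w n = (1 - q ^ (n + 1)) * w (n + 1)) (h0 : v 0 = 0) (h1 : v 1 = 0) :
    S 0 0 0 0 1 1 1 1 1 1 1 0 0 0 0
      = S 0 0 1 0 1 2 1 2 1 2 2 0 0 0 0 + q * S 0 0 1 0 1 2 1 2 1 2 2 0 0 1 0 := by
  have z0 := litSum_eq_zero_A q w h0
  have z1 := litSum_eq_zero_B q w h1
  linear_combination (norm := skip)
    contigC v hw 0 0 0 0 1 1 1 1 1 1 1 0 0 0 0 + contigAC v hw 0 0 1 0 1 1 1 1 1 1 1 0 0 0 0 + q ^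
      2 * z0 1 1 2 1 2 3 2 2 2 2 3 0 0 1 0 + contigBC v hw 0 0 1 0 1 2 1 1 1 1 1 0 0 0 0 + q ^ 2 *
      z1 1 1 2 1 2 3 2 3 2 2 3 0 0 1 0 + contigCD v hw 0 0 1 0 1 2 1 2 1 1 1 0 0 0 0 + contigABCD
      v hw 0 0 1 0 1 2 1 2 1 2 1 0 0 0 0 + q ^ 4 * z0 2 2 3 2 3 4 3 4 3 4 5 0 1 1 1 - q *
      contigABCD v hw 1 1 1 1 2 2 2 2 2 2 2 0 0 1 0 - q ^ 6 * z0 3 3 3 3 4 4 4 4 4 4 6 0 1 2 1 - q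
      * contigAD v hw 1 1 1 1 2 2 1 2 2 2 2 0 0 1 0 - q ^ 3 * z0 2 2 2 2 3 3 3 3 3 3 4 0 0 1 1 - q
      * contigB v hw 1 0 1 1 2 2 1 2 2 2 2 0 0 1 0 - q ^ 2 * z1 2 1 2 2 3 3 2 3 3 3 4 0 0 1 0 - q
      * contigAB v hw 1 0 1 1 1 2 1 2 2 2 2 0 0 1 0 - q ^ 3 * z0 2 1 2 2 3 3 2 3 3 3 4 0 1 1 0 - q
      * contigA v hw 0 0 1 1 1 2 1 2 2 2 2 0 0 1 0 - q ^ 2 * z0 1 1 2 2 2 3 2 3 3 3 4 0 0 1 0 - q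
      * contigBD v hw 0 0 1 1 1 2 1 2 1 2 2 0 0 1 0 - q ^ 3 * z1 1 1 2 2 2 3 2 3 3 3 4 0 0 1 1 - q
      * contigD v hw 0 0 1 0 1 2 1 2 1 2 2 0 0 1 0 + q ^ 2 * contigABCD v hw 1 1 2 1 2 3 2 3 2 3 3
      0 0 1 1 + q ^ 8 * z0 3 3 4 3 4 5 4 5 4 5 7 0 1 2 2
  simp only [Nat.reduceAdd]
  ring

theorem recursion_D (hw : ∀ n, w n = (1 - q ^ (n + 1)) * w (n + 1)) (h0 : v 0 = 0) (h1 : v 1 =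
    0) (h2 : v 2 = 0) :
    S 0 0 0 0 1 1 1 1 1 1 1 0 0 0 0
      = S 0 0 0 1 1 1 2 1 2 2 2 0 0 0 0 + q * S 0 0 0 1 1 1 2 1 2 2 2 0 0 0 1 := by
  have z0 := litSum_eq_zero_A q w h0
  have z1 := litSum_eq_zero_B q w h1
  have z2 := litSum_eq_zero_C q w h2
  linear_combination (norm := skip)
    contigD v hw 0 0 0 0 1 1 1 1 1 1 1 0 0 0 0 + contigAD v hw 0 0 0 1 1 1 1 1 1 1 1 0 0 0 0 + q ^
      2 * z0 1 1 1 2 2 2 3 2 2 2 3 0 0 0 1 + contigBD v hw 0 0 0 1 1 1 2 1 1 1 1 0 0 0 0 + q ^ 2 *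
      z1 1 1 1 2 2 2 3 2 3 2 3 0 0 0 1 + contigCD v hw 0 0 0 1 1 1 2 1 2 1 1 0 0 0 0 + q ^ 2 * z2
      1 1 1 2 2 2 3 2 3 3 3 0 0 0 1 + contigABCD v hw 0 0 0 1 1 1 2 1 2 2 1 0 0 0 0 + q ^ 4 * z0 2
      2 2 3 3 3 4 3 4 4 5 0 1 1 1 - q * contigBC v hw 1 1 1 1 2 2 2 1 2 2 3 0 0 0 1 - q ^ 3 * z1 2
      2 2 2 3 3 3 3 3 3 5 0 0 1 1 - q * contigAB v hw 1 1 1 1 1 2 2 1 2 2 3 0 0 0 1 - q ^ 3 * z0 2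
      2 2 2 3 3 3 2 3 3 5 0 1 0 1 - q * contigA v hw 0 1 1 1 1 2 2 1 2 2 3 0 0 0 1 - q ^ 2 * z0 1
      2 2 2 2 3 3 2 3 3 5 0 0 0 1 - q * contigC v hw 0 1 0 1 1 2 2 1 2 2 3 0 0 0 1 - q ^ 2 * z2 1
      2 1 2 2 3 3 2 3 3 5 0 0 0 1 - q * contigABCD v hw 0 1 0 1 1 2 2 1 2 2 2 0 0 0 1 - q ^ 6 * z0
      2 3 2 3 3 4 4 3 4 4 6 0 1 1 2 - q * contigAC v hw 0 1 0 1 1 1 2 1 2 2 2 0 0 0 1 - q ^ 3 * z0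
      1 2 1 2 2 3 3 2 3 3 4 0 0 1 1 - q * contigB v hw 0 0 0 1 1 1 2 1 2 2 2 0 0 0 1 - q ^ 2 * z1
      1 1 1 2 2 2 3 2 3 3 4 0 0 0 1
  simp only [Nat.reduceAdd]
  ring

end Recursions

end FourColor

/-! ### Solving the recursions: the product formula. -/

namespace FourColor

open Finset

section Product

variable {R : Type*} [CommRing R] (q : R) (w : ℕ → R)

theorem litSum_constraint_A (v : Fin 4 → ℕ) (a b c d ab ac ad bc bd cd e u₁ u₂ u₃ u₄ : ℕ) :
    q ^ u₁ * litSum q w v (a + 1) b c d (ab + 1) (ac + 1) (ad + 1) bc bd cd (e + 1) u₁ u₂ u₃ u₄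
      = q ^ v 0 * litSum q w v a b c d ab ac ad bc bd cd e u₁ u₂ u₃ u₄ := by
  have h := colorSum_constraint (q := q) (w := w) v (colorVec a b c d ab ac ad bc bd cd e)
    ![u₁, u₂, u₃, u₄] 0
  have h1 : colorVec a b c d ab ac ad bc bd cd e + (fun x => Color.letters x 0)
      = colorVec (a + 1) b c d (ab + 1) (ac + 1) (ad + 1) bc bd cd (e + 1) := by
    funext x; cases x <;> rfl
  rw [h1] at h
  exact h

theorem litSum_shift_A (i j k l a b c d ab ac ad bc bd cd e u₁ u₂ u₃ u₄ : ℕ) :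
    litSum q w ![i + 1, j, k, l] a b c d ab ac ad bc bd cd e (u₁ + 1) u₂ u₃ u₄
      = litSum q w ![i, j, k, l] a b c d ab ac ad bc bd cd e u₁ u₂ u₃ u₄ := by
  refine colorSum_shift _ ?_
  funext x; fin_cases x <;> simp [add_comm, add_left_comm]

theorem litSum_constraint_B (v : Fin 4 → ℕ) (a b c d ab ac ad bc bd cd e u₁ u₂ u₃ u₄ : ℕ) :
    q ^ u₂ * litSum q w v a (b + 1) c d (ab + 1) ac ad (bc + 1) (bd + 1) cd (e + 1) u₁ u₂ u₃ u₄
      = q ^ v 1 * litSum q w v a b c d ab ac ad bc bd cd e u₁ u₂ u₃ u₄ := by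
  have h := colorSum_constraint (q := q) (w := w) v (colorVec a b c d ab ac ad bc bd cd e)
    ![u₁, u₂, u₃, u₄] 1
  have h1 : colorVec a b c d ab ac ad bc bd cd e + (fun x => Color.letters x 1)
      = colorVec a (b + 1) c d (ab + 1) ac ad (bc + 1) (bd + 1) cd (e + 1) := by
    funext x; cases x <;> rfl
  rw [h1] at h
  exact h

theorem litSum_shift_B (i j k l a b c d ab ac ad bc bd cd e u₁ u₂ u₃ u₄ : ℕ) :
    litSum q w ![i, j + 1, k, l] a b c d ab ac ad bc bd cd e u₁ (u₂ + 1) u₃ u₄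
      = litSum q w ![i, j, k, l] a b c d ab ac ad bc bd cd e u₁ u₂ u₃ u₄ := by
  refine colorSum_shift _ ?_
  funext x; fin_cases x <;> simp [add_comm, add_left_comm]

theorem litSum_constraint_C (v : Fin 4 → ℕ) (a b c d ab ac ad bc bd cd e u₁ u₂ u₃ u₄ : ℕ) :
    q ^ u₃ * litSum q w v a b (c + 1) d ab (ac + 1) ad (bc + 1) bd (cd + 1) (e + 1) u₁ u₂ u₃ u₄
      = q ^ v 2 * litSum q w v a b c d ab ac ad bc bd cd e u₁ u₂ u₃ u₄ := by
  have h := colorSum_constraint (q := q) (w := w) v (colorVec a b c d ab ac ad bc bd cd e)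
    ![u₁, u₂, u₃, u₄] 2
  have h1 : colorVec a b c d ab ac ad bc bd cd e + (fun x => Color.letters x 2)
      = colorVec a b (c + 1) d ab (ac + 1) ad (bc + 1) bd (cd + 1) (e + 1) := by
    funext x; cases x <;> rfl
  rw [h1] at h
  exact h

theorem litSum_shift_C (i j k l a b c d ab ac ad bc bd cd e u₁ u₂ u₃ u₄ : ℕ) :
    litSum q w ![i, j, k + 1, l] a b c d ab ac ad bc bd cd e u₁ u₂ (u₃ + 1) u₄
      = litSum q w ![i, j, k, l] a b c d ab ac ad bc bd cd e u₁ u₂ u₃ u₄ := by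
  refine colorSum_shift _ ?_
  funext x; fin_cases x <;> simp [add_comm, add_left_comm]

theorem litSum_constraint_D (v : Fin 4 → ℕ) (a b c d ab ac ad bc bd cd e u₁ u₂ u₃ u₄ : ℕ) :
    q ^ u₄ * litSum q w v a b c (d + 1) ab ac (ad + 1) bc (bd + 1) (cd + 1) (e + 1) u₁ u₂ u₃ u₄
      = q ^ v 3 * litSum q w v a b c d ab ac ad bc bd cd e u₁ u₂ u₃ u₄ := by
  have h := colorSum_constraint (q := q) (w := w) v (colorVec a b c d ab ac ad bc bd cd e)
    ![u₁, u₂, u₃, u₄] 3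
  have h1 : colorVec a b c d ab ac ad bc bd cd e + (fun x => Color.letters x 3)
      = colorVec a b c (d + 1) ab ac (ad + 1) bc (bd + 1) (cd + 1) (e + 1) := by
    funext x; cases x <;> rfl
  rw [h1] at h
  exact h

theorem litSum_shift_D (i j k l a b c d ab ac ad bc bd cd e u₁ u₂ u₃ u₄ : ℕ) :
    litSum q w ![i, j, k, l + 1] a b c d ab ac ad bc bd cd e u₁ u₂ u₃ (u₄ + 1)
      = litSum q w ![i, j, k, l] a b c d ab ac ad bc bd cd e u₁ u₂ u₃ u₄ := by
  refine colorSum_shift _ ?_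
  funext x; fin_cases x <;> simp [add_comm, add_left_comm]

/-- The subtraction-free form of the generating function of Type-1 partitions. -/
noncomputable def fullSum (v : Fin 4 → ℕ) : R :=
  litSum q w v 0 0 0 0 1 1 1 1 1 1 1 0 0 0 0 + q ^ 3 * litSum q w v 2 2 2 2 3 3 3 3 2 2 4 1 1 1 0
    + q ^ 3 * litSum q w v 2 2 2 2 3 3 3 3 3 2 4 1 1 0 1 + q ^ 3 * litSum q w v 2 2 2 2 3 3 3 3 3
    3 4 1 0 1 1 + q ^ 3 * litSum q w v 3 2 2 2 3 3 3 3 3 3 5 0 1 1 1 + q ^ 6 * litSum q w v 3 3 3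
    3 4 4 4 4 4 4 6 2 1 1 1

/-- The form of `fullSum` in the absence of the letter `A`. -/
noncomputable def tripleSum (v : Fin 4 → ℕ) : R :=
  litSum q w v 0 0 0 0 1 1 1 1 1 1 1 0 0 0 0 + q ^ 3 * litSum q w v 3 2 2 2 3 3 3 3 3 3 5 0 1 1 1

/-- Four of the six summands have u₁ > 0, so they require at least one letter A. -/
theorem fullSum_eq_tripleSum {v : Fin 4 → ℕ} (h : v 0 = 0) :
    fullSum q w v = tripleSum q w v := by
  have z := litSum_eq_zero_A q w h
  rw [fullSum, tripleSum, z 2 2 2 2 3 3 3 3 2 2 4 0 1 1 0, z 2 2 2 2 3 3 3 3 3 2 4 0 1 0 1, z 2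
      2 2 2 3 3 3 3 3 3 4 0 0 1 1, z 3 3 3 3 4 4 4 4 4 4 6 1 1 1 1]
  ring

theorem tripleSum_eq {v : Fin 4 → ℕ} (h : v 1 = 0) :
    tripleSum q w v = litSum q w v 0 0 0 0 1 1 1 1 1 1 1 0 0 0 0 := by
  have z := litSum_eq_zero_B q w h
  rw [tripleSum, z 3 2 2 2 3 3 3 3 3 3 5 0 0 1 1]
  ring

variable {q w}

theorem fullSum_succ_A (hw : ∀ n, w n = (1 - q ^ (n + 1)) * w (n + 1)) (i j k l : ℕ) :
    (1 - q ^ (i + 1)) * fullSum q w ![i + 1, j, k, l]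
      = q ^ (i + 1) * fullSum q w ![i, j, k, l] := by
  have hv : ![i + 1, j, k, l] 0 = i + 1 := rfl
  unfold fullSum
  linear_combination (norm := skip)
    recursion_A ![i + 1, j, k, l] hw  + litSum_constraint_A q w ![i + 1, j, k, l] 0 0 0 0 1 1 1 1
      1 1 1 0 0 0 0 + litSum_constraint_A q w ![i + 1, j, k, l] 0 0 0 0 1 1 1 1 1 1 1 1 0 0 0 + q
      ^ (i + 1) * litSum_shift_A q w i j k l 0 0 0 0 1 1 1 1 1 1 1 0 0 0 0 + q ^ 3 *
      litSum_constraint_A q w ![i + 1, j, k, l] 2 2 2 2 3 3 3 3 2 2 4 1 1 1 0 + q ^ 3 *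
      litSum_constraint_A q w ![i + 1, j, k, l] 2 2 2 2 3 3 3 3 2 2 4 2 1 1 0 + q ^ (i + 1) * q ^
      3 * litSum_shift_A q w i j k l 2 2 2 2 3 3 3 3 2 2 4 1 1 1 0 + q ^ 3 * litSum_constraint_A q
      w ![i + 1, j, k, l] 2 2 2 2 3 3 3 3 3 2 4 1 1 0 1 + q ^ 3 * litSum_constraint_A q w ![i + 1,
      j, k, l] 2 2 2 2 3 3 3 3 3 2 4 2 1 0 1 + q ^ (i + 1) * q ^ 3 * litSum_shift_A q w i j k l 2
      2 2 2 3 3 3 3 3 2 4 1 1 0 1 + q ^ 3 * litSum_constraint_A q w ![i + 1, j, k, l] 2 2 2 2 3 3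
      3 3 3 3 4 1 0 1 1 + q ^ 3 * litSum_constraint_A q w ![i + 1, j, k, l] 2 2 2 2 3 3 3 3 3 3 4
      2 0 1 1 + q ^ (i + 1) * q ^ 3 * litSum_shift_A q w i j k l 2 2 2 2 3 3 3 3 3 3 4 1 0 1 1 + q
      ^ 3 * litSum_constraint_A q w ![i + 1, j, k, l] 3 2 2 2 3 3 3 3 3 3 5 0 1 1 1 + q ^ 3 *
      litSum_constraint_A q w ![i + 1, j, k, l] 3 2 2 2 3 3 3 3 3 3 5 1 1 1 1 + q ^ (i + 1) * q ^
      3 * litSum_shift_A q w i j k l 3 2 2 2 3 3 3 3 3 3 5 0 1 1 1 + q ^ 6 * litSum_constraint_A q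
      w ![i + 1, j, k, l] 3 3 3 3 4 4 4 4 4 4 6 2 1 1 1 + q ^ 6 * litSum_constraint_A q w ![i + 1,
      j, k, l] 3 3 3 3 4 4 4 4 4 4 6 3 1 1 1 + q ^ (i + 1) * q ^ 6 * litSum_shift_A q w i j k l 3
      3 3 3 4 4 4 4 4 4 6 2 1 1 1
  simp only [Nat.reduceAdd, hv]
  ring

theorem tripleSum_succ_B (hw : ∀ n, w n = (1 - q ^ (n + 1)) * w (n + 1)) (j k l : ℕ) :
    (1 - q ^ (j + 1)) * tripleSum q w ![0, j + 1, k, l]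
      = q ^ (j + 1) * tripleSum q w ![0, j, k, l] := by
  have hv : ![0, j + 1, k, l] 1 = j + 1 := rfl
  unfold tripleSum
  linear_combination (norm := skip)
    recursion_B ![0, j + 1, k, l] hw rfl + litSum_constraint_B q w ![0, j + 1, k, l] 0 0 0 0 1 1 1
      1 1 1 1 0 0 0 0 + litSum_constraint_B q w ![0, j + 1, k, l] 0 0 0 0 1 1 1 1 1 1 1 0 1 0 0 +
      q ^ (j + 1) * litSum_shift_B q w 0 j k l 0 0 0 0 1 1 1 1 1 1 1 0 0 0 0 + q ^ 3 *
      litSum_constraint_B q w ![0, j + 1, k, l] 3 2 2 2 3 3 3 3 3 3 5 0 1 1 1 + q ^ 3 *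
      litSum_constraint_B q w ![0, j + 1, k, l] 3 2 2 2 3 3 3 3 3 3 5 0 2 1 1 + q ^ (j + 1) * q ^
      3 * litSum_shift_B q w 0 j k l 3 2 2 2 3 3 3 3 3 3 5 0 1 1 1
  simp only [Nat.reduceAdd, hv]
  ring

theorem litSum_succ_C (hw : ∀ n, w n = (1 - q ^ (n + 1)) * w (n + 1)) (k l : ℕ) :
    (1 - q ^ (k + 1)) * litSum q w ![0, 0, k + 1, l] 0 0 0 0 1 1 1 1 1 1 1 0 0 0 0
      = q ^ (k + 1) * litSum q w ![0, 0, k, l] 0 0 0 0 1 1 1 1 1 1 1 0 0 0 0 := by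
  have hv : ![0, 0, k + 1, l] 2 = k + 1 := rfl
  linear_combination (norm := skip)
    recursion_C ![0, 0, k + 1, l] hw rfl rfl + litSum_constraint_C q w ![0, 0, k + 1, l] 0 0 0 0 1
      1 1 1 1 1 1 0 0 0 0 + litSum_constraint_C q w ![0, 0, k + 1, l] 0 0 0 0 1 1 1 1 1 1 1 0 0 1
      0 + q ^ (k + 1) * litSum_shift_C q w 0 0 k l 0 0 0 0 1 1 1 1 1 1 1 0 0 0 0
  simp only [Nat.reduceAdd, hv]
  ring

theorem litSum_succ_D (hw : ∀ n, w n = (1 - q ^ (n + 1)) * w (n + 1)) (l : ℕ) :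
    (1 - q ^ (l + 1)) * litSum q w ![0, 0, 0, l + 1] 0 0 0 0 1 1 1 1 1 1 1 0 0 0 0
      = q ^ (l + 1) * litSum q w ![0, 0, 0, l] 0 0 0 0 1 1 1 1 1 1 1 0 0 0 0 := by
  have hv : ![0, 0, 0, l + 1] 3 = l + 1 := rfl
  linear_combination (norm := skip)
    recursion_D ![0, 0, 0, l + 1] hw rfl rfl rfl + litSum_constraint_D q w ![0, 0, 0, l + 1] 0 0 0
      0 1 1 1 1 1 1 1 0 0 0 0 + litSum_constraint_D q w ![0, 0, 0, l + 1] 0 0 0 0 1 1 1 1 1 1 1 0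
      0 0 1 + q ^ (l + 1) * litSum_shift_D q w 0 0 0 l 0 0 0 0 1 1 1 1 1 1 1 0 0 0 0
  simp only [Nat.reduceAdd, hv]
  ring

theorem litSum_zero (hw₀ : w 0 = 1) : litSum q w ![0, 0, 0, 0] 0 0 0 0 1 1 1 1 1 1 1 0 0 0 0 = 1
    := by
  have h : letterFinset ![0, 0, 0, 0] ![0, 0, 0, 0] = {0} := by
    ext ν
    rw [mem_letterFinset, mem_singleton]
    constructor
    · intro h
      funext x
      obtain ⟨t, ht⟩ := x.exists_letter
      have h1 : ∑ y, ν y * y.letters t = 0 := by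
        have := h t
        have h0 : (![0, 0, 0, 0] : Fin 4 → ℕ) t = 0 := by fin_cases t <;> rfl
        omega
      have h2 := (sum_eq_zero_iff.1 h1) x (mem_univ x)
      rw [ht, mul_one] at h2
      exact h2
    · rintro rfl t
      simp
  rw [litSum, colorSum, h, sum_singleton]
  simp [quadExp, weightedLength, hw₀]

/-- The generating function `q ^ (n (n + 1) / 2) / (q; q)_n` of partitions into `n` distinct
parts. -/
def distinctTerm (q : R) (w : ℕ → R) (n : ℕ) : R := q ^ (n + 1).choose 2 * w n

theorem distinctTerm_succ (hw : ∀ n, w n = (1 - q ^ (n + 1)) * w (n + 1)) (n : ℕ) :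
    (1 - q ^ (n + 1)) * distinctTerm q w (n + 1) = q ^ (n + 1) * distinctTerm q w n := by
  rw [distinctTerm, distinctTerm, hw n, Nat.choose_succ_succ' (n + 1) 1, Nat.choose_one_right]
  ring

/-- Each factor `distinctTerm` satisfies the same first-order recursion as the sum, and in a domain
1 - q^(n+1) can be cancelled. Only the base case of each induction passes to the next letter. -/
theorem fullSum_eq [IsDomain R] (hq : ∀ n, 1 - q ^ (n + 1) ≠ 0) (hw₀ : w 0 = 1)
    (hw : ∀ n, w n = (1 - q ^ (n + 1)) * w (n + 1)) (i j k l : ℕ) :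
    fullSum q w ![i, j, k, l] = distinctTerm q w i * distinctTerm q w j * distinctTerm q w k
      * distinctTerm q w l := by
  have h₀ : distinctTerm q w 0 = 1 := by simp [distinctTerm, hw₀]
  induction i with
  | succ i ih =>
    refine mul_left_cancel₀ (hq i) ?_
    rw [fullSum_succ_A hw, ih]
    linear_combination -(distinctTerm q w j * distinctTerm q w k * distinctTerm q w l)
      * distinctTerm_succ hw i
  | zero =>
    rw [fullSum_eq_tripleSum q w rfl, h₀, one_mul]
    induction j with
    | succ j ih =>
      refine mul_left_cancel₀ (hq j) ?_
      rw [tripleSum_succ_B hw, ih]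
      linear_combination -(distinctTerm q w k * distinctTerm q w l) * distinctTerm_succ hw j
    | zero =>
      rw [tripleSum_eq q w rfl, h₀, one_mul]
      induction k with
      | succ k ih =>
        refine mul_left_cancel₀ (hq k) ?_
        rw [litSum_succ_C hw, ih]
        linear_combination -(distinctTerm q w l) * distinctTerm_succ hw k
      | zero =>
        rw [h₀, one_mul]
        induction l with
        | succ l ih =>
          refine mul_left_cancel₀ (hq l) ?_
          rw [litSum_succ_D hw, ih]
          linear_combination -distinctTerm_succ hw l
        | zero => rw [h₀, litSum_zero hw₀]

end Product

end FourColor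

/-! ### Generating functions of sets with a size function, and 1 / (q;q)_n. -/

namespace FourColor

open Finset PowerSeries

section GeneratingFunction

variable {α β : Type*}

/-- The generating function of the elements of `S`, counted by the size `s`. -/
noncomputable def gf (S : Set α) (s : α → ℕ) : ℚ⟦X⟧ :=
  PowerSeries.mk fun n => ({a ∈ S | s a = n}.ncard : ℚ)

/-- Only finitely many elements of `S` have a given size. -/
def FiniteFibers (S : Set α) (s : α → ℕ) : Prop := ∀ n, {a ∈ S | s a = n}.Finite

theorem FiniteFibers.subset {S T : Set α} {s : α → ℕ} (h : FiniteFibers T s) (hST : S ⊆ T) :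
    FiniteFibers S s :=
  fun n => (h n).subset fun _ ha => ⟨hST ha.1, ha.2⟩

theorem coeff_gf (S : Set α) (s : α → ℕ) (n : ℕ) :
    coeff n (gf S s) = ({a ∈ S | s a = n}.ncard : ℚ) := by
  rw [gf, coeff_mk]

theorem gf_empty (s : α → ℕ) : gf ∅ s = 0 := by
  ext n
  simp [coeff_gf]

/-- Finite fibers are needed because `ncard` is 0 on infinite sets, which would break additivity. -/
theorem gf_union {S T : Set α} {s : α → ℕ} (hS : FiniteFibers S s) (hT : FiniteFibers T s)
    (h : Disjoint S T) : gf (S ∪ T) s = gf S s + gf T s := by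
  ext n
  rw [map_add, coeff_gf, coeff_gf, coeff_gf, ← Nat.cast_add, ← Set.ncard_union_eq _ (hS n) (hT n)]
  · congr 2
    ext a
    simp only [Set.mem_union, Set.mem_ofPred_eq, or_and_right]
  · exact Set.disjoint_left.2 fun a ha hb => Set.disjoint_left.1 h ha.1 hb.1

theorem gf_iUnion {ι : Type*} [Fintype ι] {S : ι → Set α} {s : α → ℕ}
    (hS : ∀ i, FiniteFibers (S i) s) (h : ∀ i j, i ≠ j → Disjoint (S i) (S j)) :
    gf (⋃ i, S i) s = ∑ i, gf (S i) s := by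
  classical
  have key : ∀ t : Finset ι, gf (⋃ i ∈ t, S i) s = ∑ i ∈ t, gf (S i) s := by
    intro t
    induction t using Finset.induction_on with
    | empty => simp [gf_empty]
    | insert i t hi ih =>
      rw [sum_insert hi, ← ih, Finset.set_biUnion_insert, gf_union (hS i)]
      · intro n
        refine (t.finite_toSet.biUnion fun j _ => hS j n).subset ?_
        rintro a ⟨ha, hn⟩
        simp only [Set.mem_iUnion] at ha ⊢
        obtain ⟨j, hj, hja⟩ := ha
        exact ⟨j, hj, hja, hn⟩
      · rw [Set.disjoint_iUnion₂_right]
        exact fun j hj => h i j fun hij => hi (hij ▸ hj)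
  simpa using key univ

theorem gf_of_bijOn {S : Set α} {T : Set β} {s : α → ℕ} {t : β → ℕ} (f : α → β)
    (h : Set.BijOn f S T) (k : ℕ) (hs : ∀ a ∈ S, t (f a) = s a + k) :
    gf T t = X ^ k * gf S s := by
  ext n
  rw [coeff_X_pow_mul', coeff_gf]
  split_ifs with hk
  · rw [coeff_gf]
    have himg : f '' {a ∈ S | s a = n - k} = {b ∈ T | t b = n} := by
      ext b
      constructor
      · rintro ⟨a, ⟨ha, han⟩, rfl⟩
        exact ⟨h.mapsTo ha, by rw [hs a ha]; omega⟩
      · rintro ⟨hb, hbn⟩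
        obtain ⟨a, ha, rfl⟩ := h.surjOn hb
        exact ⟨a, ⟨ha, by have := hs a ha; omega⟩, rfl⟩
    rw [← himg, Set.InjOn.ncard_image (h.injOn.mono fun a ha => ha.1)]
  · have : {b ∈ T | t b = n} = ∅ := by
      rw [Set.eq_empty_iff_forall_notMem]
      rintro b ⟨hb, hbn⟩
      obtain ⟨a, ha, rfl⟩ := h.surjOn hb
      have := hs a ha
      omega
    rw [this]
    simp

theorem gf_image {S : Set α} {s : α → ℕ} {t : β → ℕ} (f : α → β) (hf : Function.Injective f)
    (k : ℕ) (hs : ∀ a ∈ S, t (f a) = s a + k) : gf (f '' S) t = X ^ k * gf S s :=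
  gf_of_bijOn f hf.injOn.bijOn_image k hs

theorem gf_prod {S : Set α} {T : Set β} {s : α → ℕ} {t : β → ℕ} (hS : FiniteFibers S s)
    (hT : FiniteFibers T t) : gf (S ×ˢ T) (fun p => s p.1 + t p.2) = gf S s * gf T t := by
  classical
  ext n
  rw [coeff_mul, coeff_gf]
  have h : {p ∈ S ×ˢ T | s p.1 + t p.2 = n}
      = ((antidiagonal n).biUnion fun k => (hS k.1).toFinset ×ˢ (hT k.2).toFinset : Finset _) := by
    ext p
    simp only [Set.mem_ofPred_eq, Set.mem_prod, coe_biUnion, Set.mem_iUnion, mem_coe,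
      mem_product, Set.Finite.mem_toFinset, HasAntidiagonal.mem_antidiagonal]
    constructor
    · rintro ⟨⟨h1, h2⟩, h3⟩
      exact ⟨(s p.1, t p.2), h3, ⟨h1, rfl⟩, h2, rfl⟩
    · rintro ⟨k, hk, ⟨h1, h2⟩, h3, h4⟩
      exact ⟨⟨h1, h3⟩, by rw [h2, h4, hk]⟩
  rw [h, Set.ncard_coe_finset, card_biUnion]
  · rw [Nat.cast_sum]
    refine sum_congr rfl fun k _ => ?_
    rw [card_product, Nat.cast_mul, coeff_gf, coeff_gf, Set.ncard_eq_toFinset_card _ (hS k.1),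
      Set.ncard_eq_toFinset_card _ (hT k.2)]
  · intro k _ k' _ hkk'
    rw [Function.onFun, Finset.disjoint_left]
    intro p hp hp'
    simp only [mem_product, Set.Finite.mem_toFinset, Set.mem_ofPred_eq] at hp hp'
    exact hkk' (Prod.ext (hp.1.2.symm.trans hp'.1.2) (hp.2.2.symm.trans hp'.2.2))

/-- A list of positive sizes with sum n has at most n entries, each at most n. -/
theorem finiteFibers_list {σ : β → ℕ} (hσ : ∀ n, {b | σ b ≤ n}.Finite) :
    FiniteFibers {l : List β | ∀ b ∈ l, 0 < σ b} (fun l => (l.map σ).sum) := by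
  intro n
  have : Finite {b // σ b ≤ n} := (hσ n).to_subtype
  have key : ∀ l : List β, (∀ b ∈ l, 0 < σ b) →
      l.length ≤ (l.map σ).sum ∧ ∀ b ∈ l, σ b ≤ (l.map σ).sum := by
    intro l
    induction l with
    | nil => simp
    | cons x l ih =>
      intro h
      simp only [List.mem_cons, forall_eq_or_imp] at h
      simp only [List.length_cons, List.map_cons, List.sum_cons, List.mem_cons, forall_eq_or_imp]
      obtain ⟨h1, h2⟩ := ih h.2
      refine ⟨by omega, by omega, fun b hb => ?_⟩
      have := h2 b hb
      omega
  refine ((List.finite_length_le {b // σ b ≤ n} n).image (List.map Subtype.val)).subset ?_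
  rintro l ⟨hl, hn⟩
  have hk := key l hl
  rw [show (l.map σ).sum = n from hn] at hk
  exact ⟨l.attach.map (fun b => ⟨b.1, hk.2 b.1 b.2⟩), by simpa using hk.1,
    by simp [List.map_map, Function.comp_def]⟩

end GeneratingFunction

section Pochhammer

/-- The power series `1 / (q; q)_n`. -/
noncomputable def invPoch (n : ℕ) : ℚ⟦X⟧ := (∏ k ∈ range n, (1 - X ^ (k + 1)))⁻¹

theorem invPoch_zero : invPoch 0 = 1 := by simp [invPoch]

theorem one_sub_X_pow_ne_zero (n : ℕ) : (1 - X ^ (n + 1) : ℚ⟦X⟧) ≠ 0 := by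
  intro h
  have := congrArg (constantCoeff (R := ℚ)) h
  simp at this

theorem invPoch_succ (n : ℕ) : invPoch n = (1 - X ^ (n + 1)) * invPoch (n + 1) := by
  rw [invPoch, invPoch, prod_range_succ, PowerSeries.mul_inv_rev, ← mul_assoc,
    PowerSeries.mul_inv_cancel _ (by simp), one_mul]

end Pochhammer

end FourColor

/-! ### Recursions on the smallest part. -/

namespace FourColor

open Finset PowerSeries

section Recursion

/-- The difference f m - g m does not depend on m, yet it is divisible by arbitrarily high powers of
X, so it vanishes. This is how a closed form is verified for lists bounded below by m: check the
recursion in m and the divisibility. -/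
theorem eq_of_telescoping {f g d : ℕ → ℚ⟦X⟧} (hf : ∀ m, f m = f (m + 1) + d m)
    (hg : ∀ m, g m = g (m + 1) + d m) (hf' : ∀ m, X ^ m ∣ f m) (hg' : ∀ m, X ^ m ∣ g m) :
    f = g := by
  have h : ∀ k m, f m - g m = f (m + k) - g (m + k) := by
    intro k
    induction k with
    | zero => intro m; rfl
    | succ k ih =>
      intro m
      rw [ih m, hf (m + k), hg (m + k), ← add_assoc]
      ring
  funext m
  ext n
  rw [← sub_eq_zero, ← map_sub, h (n + 1) m]
  have hd : X ^ (n + 1) ∣ f (m + (n + 1)) - g (m + (n + 1)) :=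
    (pow_dvd_pow X (Nat.le_add_left _ _)).trans (dvd_sub (hf' _) (hg' _))
  exact X_pow_dvd_iff.1 hd n (Nat.lt_succ_self n)

theorem X_pow_dvd_gf {α : Type*} {S : Set α} {s : α → ℕ} {m : ℕ} (h : ∀ a ∈ S, m ≤ s a) :
    X ^ m ∣ gf S s := by
  rw [X_pow_dvd_iff]
  intro n hn
  have : {a ∈ S | s a = n} = ∅ := by
    rw [Set.eq_empty_iff_forall_notMem]
    rintro a ⟨ha, han⟩
    have := h a ha
    omega
  rw [coeff_gf, this]
  simp

theorem gf_singleton_nil {α : Type*} (s : List α → ℕ) (h : s [] = 0) : gf {[]} s = 1 := by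
  ext n
  rw [coeff_gf, coeff_one]
  have : {l ∈ ({[]} : Set (List α)) | s l = n} = if n = 0 then {[]} else ∅ := by
    ext l
    by_cases hn : n = 0
    · subst hn
      simp only [Set.mem_ofPred_eq, Set.mem_singleton_iff, if_true]
      exact ⟨fun h => h.1, fun hl => ⟨hl, hl ▸ h⟩⟩
    · simp only [Set.mem_ofPred_eq, Set.mem_singleton_iff, if_neg hn, Set.mem_empty_iff_false,
        iff_false, not_and]
      rintro rfl h'
      exact hn (h'.symm.trans h)
  rw [this]
  split_ifs <;> simp

/-- Lists of `r` integers exceeding `m`, in increasing order with gaps at least `g`. -/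
def gapLists (g m r : ℕ) : Set (List ℕ) :=
  {l | l.Pairwise (fun x y => x + g ≤ y) ∧ (∀ x ∈ l, m + 1 ≤ x) ∧ l.length = r}

theorem gapLists_finiteFibers (g m r : ℕ) : FiniteFibers (gapLists g m r) List.sum := by
  have h := (finiteFibers_list (σ := fun n : ℕ => n) fun n => Set.finite_Iic n)
  simp only [List.map_id'] at h
  refine h.subset fun l hl x hx => ?_
  have := hl.2.1 x hx
  omega

theorem gapLists_zero (g m : ℕ) : gapLists g m 0 = {[]} := by
  ext l
  rw [Set.mem_singleton_iff]
  constructor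
  · exact fun h => List.length_eq_zero_iff.1 h.2.2
  · rintro rfl
    exact ⟨List.Pairwise.nil, by simp, rfl⟩

/-- Either the smallest entry exceeds m + 1, or it equals m + 1 and the others exceed m + g. -/
theorem gapLists_succ {g : ℕ} (hg : 1 ≤ g) (m r : ℕ) :
    gapLists g m (r + 1)
      = gapLists g (m + 1) (r + 1) ∪ List.cons (m + 1) '' gapLists g (m + g) r := by
  ext l
  constructor
  · rintro ⟨h1, h2, h3⟩
    obtain _ | ⟨x, l⟩ := l
    · simp at h3
    rw [List.pairwise_cons] at h1
    have hx := h2 x (by simp)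
    rcases hx.eq_or_lt with rfl | hx
    · refine Or.inr ⟨l, ⟨h1.2, fun y hy => ?_, by simpa using h3⟩, rfl⟩
      have := h1.1 y hy
      omega
    · refine Or.inl ⟨List.pairwise_cons.2 h1, fun y hy => ?_, h3⟩
      rcases List.mem_cons.1 hy with rfl | hy
      · exact hx
      · have := h1.1 y hy
        omega
  · rintro (⟨h1, h2, h3⟩ | ⟨l, ⟨h1, h2, h3⟩, rfl⟩)
    · exact ⟨h1, fun x hx => by have := h2 x hx; omega, h3⟩
    · refine ⟨List.pairwise_cons.2 ⟨fun y hy => ?_, h1⟩, fun y hy => ?_, by simp [h3]⟩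
      · have := h2 y hy
        omega
      · rcases List.mem_cons.1 hy with rfl | hy
        · exact le_rfl
        · have := h2 y hy
          omega

theorem gf_gapLists {g : ℕ} (hg : 1 ≤ g) (m r : ℕ) :
    gf (gapLists g m r) List.sum = X ^ ((m + 1) * r + g * r.choose 2) * invPoch r := by
  induction r generalizing m with
  | zero => simp [gapLists_zero, gf_singleton_nil List.sum List.sum_nil, invPoch_zero]
  | succ r ih =>
    refine congrFun (eq_of_telescoping (f := fun m => gf (gapLists g m (r + 1)) List.sum)
      (g := fun m => X ^ ((m + 1) * (r + 1) + g * (r + 1).choose 2) * invPoch (r + 1))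
      (d := fun m => X ^ (m + 1) * (X ^ ((m + g + 1) * r + g * r.choose 2) * invPoch r))
      ?_ ?_ ?_ ?_) m
    · intro m
      rw [gapLists_succ hg m r, gf_union (gapLists_finiteFibers _ _ _), gf_image (s := List.sum)
        (List.cons (m + 1)) List.cons_injective (m + 1), ih]
      · intro l _
        rw [List.sum_cons, add_comm]
      · refine (gapLists_finiteFibers g m (r + 1)).subset ?_
        rw [gapLists_succ hg m r]
        exact Set.subset_union_right
      · rw [Set.disjoint_left]
        rintro _ ⟨-, h2, -⟩ ⟨l, -, rfl⟩
        have := h2 (m + 1) (by simp)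
        omega
    · intro m
      rw [invPoch_succ r, Nat.choose_succ_succ' r 1, Nat.choose_one_right]
      ring
    · intro m
      refine X_pow_dvd_gf ?_
      rintro l ⟨-, h2, h3⟩
      obtain _ | ⟨x, l⟩ := l
      · simp at h3
      · have := h2 x (by simp)
        rw [List.sum_cons]
        omega
    · intro m
      refine Dvd.dvd.mul_right (pow_dvd_pow X ?_) _
      nlinarith

/-- The colors that may follow the given color (`none` stands for the absence of a restriction) in
a part that is larger by one. -/
def Allowed : Option Color → Color → Prop
  | none, _ => True
  | some c, x => (x = c ∧ x.IsPrimary) ∨ c < x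

instance : ∀ p, DecidablePred (Allowed p)
  | none => fun _ => inferInstanceAs (Decidable True)
  | some c => fun x => inferInstanceAs (Decidable ((x = c ∧ x.IsPrimary) ∨ c < x))

/-- The part `y` may follow a part of size `m` in the color `p`. -/
def Follows (p : Option Color) (m : ℕ) (y : Color × ℕ) : Prop :=
  m + 1 ≤ y.2 ∧ (y.2 = m + 1 → Allowed p y.1)

/-- The increasing lists of colored parts with color counts `ν` that satisfy the gap condition and
may follow a part of size `m` in the color `p`. -/
def chains (p : Option Color) (m : ℕ) (ν : Color → ℕ) : Set (List (Color × ℕ)) :=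
  {l | l.Pairwise (fun x y => Follows (some x.1) x.2 y) ∧ (∀ y ∈ l, Follows p m y) ∧
    ∀ x, l.countP (fun y => y.1 = x) = ν x}

/-- The sum of the sizes of a list of colored parts. -/
def partSum (l : List (Color × ℕ)) : ℕ := (l.map Prod.snd).sum

theorem chains_finiteFibers (p : Option Color) (m : ℕ) (ν : Color → ℕ) :
    FiniteFibers (chains p m ν) partSum := by
  refine (finiteFibers_list (σ := fun y : Color × ℕ => y.2) fun n => ?_).subset fun l hl y hy => ?_
  · refine (Set.finite_univ.prod (Set.finite_Iic n)).subset fun y hy => ⟨trivial, hy⟩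
  · have := (hl.2.1 y hy).1
    omega

theorem countP_cons_eq (y : Color × ℕ) (l : List (Color × ℕ)) (ν : Color → ℕ) :
    (∀ x, (y :: l).countP (fun y => y.1 = x) = ν x) ↔
      ν y.1 ≠ 0 ∧ ∀ x, l.countP (fun y => y.1 = x) = (ν - Pi.single y.1 1 : Color → ℕ) x := by
  simp only [List.countP_cons, Pi.sub_apply, Pi.single_apply, decide_eq_true_eq]
  constructor
  · intro h
    have h1 := h y.1
    rw [if_pos rfl] at h1
    refine ⟨by omega, fun x => ?_⟩
    have h2 := h x
    by_cases hx : y.1 = x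
    · rw [if_pos hx] at h2
      rw [if_pos hx.symm]
      omega
    · rw [if_neg hx] at h2
      rw [if_neg (Ne.symm hx)]
      omega
  · rintro ⟨h1, h⟩ x
    have h2 := h x
    by_cases hx : y.1 = x
    · subst hx
      rw [if_pos rfl] at h2 ⊢
      omega
    · rw [if_neg (Ne.symm hx)] at h2
      rw [if_neg hx]
      omega

theorem cons_mem_chains {p : Option Color} {m : ℕ} {ν : Color → ℕ} {y : Color × ℕ}
    {l : List (Color × ℕ)} :
    y :: l ∈ chains p m ν ↔
      Follows p m y ∧ ν y.1 ≠ 0 ∧ l ∈ chains (some y.1) y.2 (ν - Pi.single y.1 1) := by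
  change (_ ∧ _ ∧ _) ↔ _ ∧ _ ∧ _ ∧ _ ∧ _
  rw [countP_cons_eq, List.pairwise_cons, List.forall_mem_cons]
  constructor
  · rintro ⟨⟨h1, h2⟩, ⟨h3, -⟩, h4, h5⟩
    exact ⟨h3, h4, h2, h1, h5⟩
  · rintro ⟨h3, h4, h2, h1, h5⟩
    refine ⟨⟨h1, h2⟩, ⟨h3, fun z hz => ?_⟩, h4, h5⟩
    -- Any later part has size at least m + 2, so the color restriction imposed by p does not
    -- concern it: only consecutive parts matter.
    have h6 := (h1 z hz).1
    have h7 := h3.1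
    exact ⟨by omega, fun h => by omega⟩

theorem nil_mem_chains {p : Option Color} {m : ℕ} {ν : Color → ℕ} :
    [] ∈ chains p m ν ↔ ν = 0 := by
  constructor
  · rintro ⟨-, -, h⟩
    funext x
    exact (h x).symm
  · rintro rfl
    exact ⟨List.Pairwise.nil, by simp, fun x => rfl⟩

/-- The lists in `chains` whose first part is `m + 1` in the color `x`. -/
def chainsFrom (p : Option Color) (m : ℕ) (ν : Color → ℕ) (x : Color) :
    Set (List (Color × ℕ)) :=
  {l | Allowed p x ∧ ν x ≠ 0 ∧
    l ∈ List.cons (x, m + 1) '' chains (some x) (m + 1) (ν - Pi.single x 1)}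

theorem chainsFrom_subset (p : Option Color) (m : ℕ) (ν : Color → ℕ) (x : Color) :
    chainsFrom p m ν x ⊆ chains p m ν := by
  rintro _ ⟨h1, h2, l, hl, rfl⟩
  exact cons_mem_chains.2 ⟨⟨le_rfl, fun _ => h1⟩, h2, hl⟩

/-- If no part has size m + 1, the color p imposes nothing, whence `none`; otherwise the unique part
of size m + 1 comes first and its color must be allowed. -/
theorem chains_eq (p : Option Color) (m : ℕ) (ν : Color → ℕ) :
    chains p m ν = chains none (m + 1) ν ∪ ⋃ x, chainsFrom p m ν x := by
  ext l
  rw [Set.mem_union, Set.mem_iUnion]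
  obtain _ | ⟨y, l⟩ := l
  · rw [nil_mem_chains, nil_mem_chains]
    refine ⟨Or.inl, ?_⟩
    rintro (h | ⟨x, -, -, l, -, h⟩)
    · exact h
    · cases h
  · rw [cons_mem_chains, cons_mem_chains]
    constructor
    · rintro ⟨h1, h2, h3⟩
      rcases h1.1.eq_or_lt with h | h
      · refine Or.inr ⟨y.1, h1.2 h.symm, h2, l, ?_, ?_⟩
        · rw [h]
          exact h3
        · rw [h]
      · exact Or.inl ⟨⟨h, fun _ => trivial⟩, h2, h3⟩
    · rintro (⟨h1, h2, h3⟩ | ⟨x, h1, h2, l', hl', h⟩)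
      · have := h1.1
        exact ⟨⟨by omega, fun h => by omega⟩, h2, h3⟩
      · cases h
        exact ⟨⟨le_rfl, fun _ => h1⟩, h2, hl'⟩

theorem gf_chainsFrom (p : Option Color) (m : ℕ) (ν : Color → ℕ) (x : Color) :
    gf (chainsFrom p m ν x) partSum
      = if Allowed p x ∧ ν x ≠ 0 then
          X ^ (m + 1) * gf (chains (some x) (m + 1) (ν - Pi.single x 1)) partSum else 0 := by
  split_ifs with h
  · have : chainsFrom p m ν x
        = List.cons (x, m + 1) '' chains (some x) (m + 1) (ν - Pi.single x 1) := by
      ext l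
      exact ⟨fun hl => hl.2.2, fun hl => ⟨h.1, h.2, hl⟩⟩
    rw [this]
    refine gf_image _ List.cons_injective _ fun l _ => ?_
    simp [partSum, add_comm]
  · have : chainsFrom p m ν x = ∅ := by
      rw [Set.eq_empty_iff_forall_notMem]
      exact fun l hl => h ⟨hl.1, hl.2.1⟩
    rw [this, gf_empty]

theorem gf_chains_eq (p : Option Color) (m : ℕ) (ν : Color → ℕ) :
    gf (chains p m ν) partSum
      = gf (chains none (m + 1) ν) partSum + ∑ x, gf (chainsFrom p m ν x) partSum := by
  have hfrom := fun x => (chains_finiteFibers p m ν).subset (chainsFrom_subset p m ν x)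
  rw [chains_eq p m ν, gf_union (chains_finiteFibers _ _ _), gf_iUnion hfrom]
  · intro x y hxy
    rw [Set.disjoint_left]
    rintro _ ⟨-, -, l, -, rfl⟩ ⟨-, -, l', -, h⟩
    cases h
    exact hxy rfl
  · refine (chains_finiteFibers p m ν).subset ?_
    exact Set.iUnion_subset fun x => chainsFrom_subset p m ν x
  · rw [Set.disjoint_iUnion_right]
    intro x
    rw [Set.disjoint_left]
    rintro _ ⟨-, h, -⟩ ⟨-, -, l, -, rfl⟩
    have := (h (x, m + 1) (by simp)).1
    simp at this

end Recursion

end FourColor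

/-! ### Closed form for lists satisfying the gap condition. -/

namespace FourColor

open Finset PowerSeries

section ClosedForm

/-- The total count of the colors preceding `x`. -/
def countBelow (ν : Color → ℕ) (x : Color) : ℕ := ∑ y, if y.rank < x.rank then ν y else 0

/-- The total count of the colors that are not allowed after `p`. -/
def countForbidden (ν : Color → ℕ) (p : Option Color) : ℕ := ∑ y, if Allowed p y then 0 else ν y

/-- The generating function of `chains p m ν`. -/
noncomputable def chainSeries (p : Option Color) (m : ℕ) (ν : Color → ℕ) : ℚ⟦X⟧ :=
  X ^ (m * ∑ x, ν x + quadExp ν + countForbidden ν p) * ∏ x, invPoch (ν x)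

theorem allowed_some_iff (c x : Color) :
    Allowed (some c) x ↔ (x = c ∧ x.IsPrimary) ∨ c.rank < x.rank := Iff.rfl

theorem countBelow_add_single (μ : Color → ℕ) (x : Color) :
    countBelow (μ + Pi.single x 1) x = countBelow μ x := by
  refine sum_congr rfl fun y _ => ?_
  split_ifs with h
  · have : y ≠ x := fun hxy => by simp [hxy] at h
    simp [this]
  · rfl

/-- The colors forbidden after x are those below x, and x itself unless it is primary. The repeated
secondary color is what the binomials of the secondary colors in `quadExp` account for. -/
theorem sum_add_countForbidden {μ : Color → ℕ} (hμ : μ .ABCD = 0) {x : Color} (hx : x ≠ .ABCD) :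
    ∑ y, μ y + countForbidden μ (some x) + 1
      = ∑ y, stepForm x y * μ y + stepConst x + countBelow μ x := by
  unfold countForbidden countBelow
  simp only [Color.sum_univ]
  cases x <;> first
    | exact absurd rfl hx
    | (simp [allowed_some_iff, Color.rank, Color.IsPrimary, stepForm, stepConst, hμ]; omega)

/-- Removing the smallest part m + 1 of color x lowers one Pochhammer index, which gives the factor
1 - X^(ν x). By `sum_add_countForbidden`, the exponents then differ only by the number of parts in
colors below x. -/
theorem chainSeries_sub_single {m : ℕ} {ν : Color → ℕ} (hν : ν .ABCD = 0) {x : Color}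
    (hx : ν x ≠ 0) :
    X ^ (m + 1) * chainSeries (some x) (m + 1) (ν - Pi.single x 1)
      = X ^ (m * ∑ x, ν x + quadExp ν + countBelow ν x) * (1 - X ^ ν x) * ∏ x, invPoch (ν x) := by
  obtain ⟨μ, rfl⟩ : ∃ μ : Color → ℕ, ν = μ + Pi.single x 1 := by
    refine ⟨ν - Pi.single x 1, funext fun y => ?_⟩
    by_cases hy : y = x
    · subst hy; simp; omega
    · simp [hy]
  have hprod : ∏ y, invPoch (μ y)
      = (1 - X ^ (μ + Pi.single x 1 : Color → ℕ) x)
        * ∏ y, invPoch ((μ + Pi.single x 1 : Color → ℕ) y) := by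
    rw [← mul_prod_erase univ _ (mem_univ x), ← mul_prod_erase univ (fun y => invPoch _)
        (mem_univ x),
      ← mul_assoc]
    congr 1
    · simpa using invPoch_succ (μ x)
    · refine prod_congr rfl fun y hy => ?_
      simp [ne_of_mem_erase hy]
  have hμ : (μ + Pi.single x 1 - Pi.single x 1 : Color → ℕ) = μ := by
    funext y
    simp
  have hsum : ∑ y, (μ + Pi.single x 1 : Color → ℕ) y = ∑ y, μ y + 1 := by
    simp [sum_add_distrib, Pi.single_apply]
  have hx' : x ≠ .ABCD := fun h => hx (h ▸ hν)
  have hμ₀ : μ .ABCD = 0 := by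
    rw [Pi.add_apply] at hν
    omega
  have hexp := sum_add_countForbidden hμ₀ hx'
  have hexp' : (m + 1) + ((m + 1) * ∑ y, μ y + quadExp μ + countForbidden μ (some x))
      = m * (∑ y, μ y + 1) + (quadExp μ + ∑ y, stepForm x y * μ y + stepConst x)
        + countBelow μ x := by
    rw [mul_add m, add_mul m 1]
    omega
  rw [hμ, chainSeries, hprod, quadExp_add_single, hsum, countBelow_add_single, ← hexp', pow_add]
  ring

/-- The allowed colors form an upper segment of the order, so the sum of X^(countBelow x) (1 - X^(ν
x)) over them telescopes to X^(countForbidden) - X^(total count). -/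
theorem chainSeries_eq (p : Option Color) (m : ℕ) {ν : Color → ℕ} (hν : ν .ABCD = 0) :
    chainSeries p m ν = chainSeries none (m + 1) ν
      + ∑ x, if Allowed p x ∧ ν x ≠ 0 then
          X ^ (m + 1) * chainSeries (some x) (m + 1) (ν - Pi.single x 1) else 0 := by
  have h1 : ∀ x, (if Allowed p x ∧ ν x ≠ 0 then
        X ^ (m + 1) * chainSeries (some x) (m + 1) (ν - Pi.single x 1) else 0)
      = X ^ (m * ∑ x, ν x + quadExp ν) * (∏ x, invPoch (ν x))
        * if Allowed p x then X ^ countBelow ν x - X ^ (countBelow ν x + ν x) else 0 := by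
    intro x
    by_cases hp : Allowed p x
    · by_cases hx : ν x = 0
      · simp [hx]
      · rw [if_pos ⟨hp, hx⟩, if_pos hp, chainSeries_sub_single hν hx]
        ring
    · rw [if_neg (fun h => hp h.1), if_neg hp, mul_zero]
  rw [sum_congr rfl fun x _ => h1 x, ← mul_sum]
  have h2 : (X : ℚ⟦X⟧) ^ countForbidden ν p = X ^ (∑ x, ν x)
      + ∑ x, if Allowed p x then X ^ countBelow ν x - X ^ (countBelow ν x + ν x) else 0 := by
    unfold countForbidden countBelow
    simp only [Color.sum_univ]
    rcases p with _ | p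
    · simp [Allowed, Color.rank, hν]
    · cases p <;> simp [allowed_some_iff, Color.rank, Color.IsPrimary, hν]
  have h3 : countForbidden ν none = 0 := by simp [countForbidden, Allowed]
  rw [chainSeries, chainSeries, h3, pow_add, h2]
  ring

theorem gf_chains (p : Option Color) (m : ℕ) {ν : Color → ℕ} (hν : ν .ABCD = 0) :
    gf (chains p m ν) partSum = chainSeries p m ν := by
  induction h : ∑ x, ν x generalizing p m ν with
  | zero =>
    have h0 : ν = 0 := by
      funext x
      exact (sum_eq_zero_iff.1 h) x (mem_univ x)
    subst h0
    have : chains p m 0 = {[]} := by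
      ext l
      rw [Set.mem_singleton_iff]
      constructor
      · intro hl
        obtain _ | ⟨y, l⟩ := l
        · rfl
        · exact absurd rfl (cons_mem_chains.1 hl).2.1
      · rintro rfl
        exact nil_mem_chains.2 rfl
    rw [this, gf_singleton_nil _ rfl]
    simp [chainSeries, quadExp, weightedLength, countForbidden, invPoch_zero]
  | succ t ih =>
    have hstep : ∀ p m, gf (chains p m ν) partSum = gf (chains none (m + 1) ν) partSum
        + ∑ x, if Allowed p x ∧ ν x ≠ 0 then
          X ^ (m + 1) * chainSeries (some x) (m + 1) (ν - Pi.single x 1) else 0 := by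
      intro p m
      rw [gf_chains_eq]
      congr 1
      refine sum_congr rfl fun x _ => ?_
      rw [gf_chainsFrom]
      split_ifs with hx
      · rw [ih]
        · simp [hν]
        · have : ∑ y, ν y = ∑ y, (ν - Pi.single x 1 : Color → ℕ) y + 1 := by
            rw [← add_sum_erase univ ν (mem_univ x),
              ← add_sum_erase univ (ν - Pi.single x 1 : Color → ℕ) (mem_univ x)]
            have h1 : ∑ y ∈ univ.erase x, (ν - Pi.single x 1 : Color → ℕ) y
                = ∑ y ∈ univ.erase x, ν y :=
              sum_congr rfl fun y hy => by simp [ne_of_mem_erase hy]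
            have h2 := hx.2
            rw [h1, Pi.sub_apply, Pi.single_eq_same]
            omega
          omega
      · rfl
    -- Without a color restriction the recursion relates m to m + 1 only, so telescoping applies. An
    -- arbitrary p then reduces to this case by a single step of the recursion.
    have hnone : (fun m => gf (chains none m ν) partSum) = fun m => chainSeries none m ν := by
      refine eq_of_telescoping (hstep none) (fun m => chainSeries_eq none m hν) (fun m => ?_)
        (fun m => ?_)
      · refine X_pow_dvd_gf fun l hl => ?_
        obtain _ | ⟨y, l⟩ := l
        · rw [nil_mem_chains] at hl
          subst hl
          simp at h
        · have := (cons_mem_chains.1 hl).1.1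
          simp only [partSum, List.map_cons, List.sum_cons]
          omega
      · refine Dvd.dvd.mul_right (pow_dvd_pow X ?_) _
        rw [h]
        nlinarith
    rw [hstep, chainSeries_eq p m hν, congrFun hnone (m + 1)]

end ClosedForm

end FourColor

/-! ### Lists of colored integers: splitting by color, and distinct parts. -/

namespace FourColor

open Finset PowerSeries

section Lists

/-- The number partitioned by a list of colored integers. -/
def listSize (l : List ColoredInt) : ℕ := (l.map ColoredInt.size).sum

theorem finiteFibers_listSize (S : Set (List ColoredInt)) : FiniteFibers S listSize :=
  (finiteFibers_list ColoredInt.finite_size_le).subset fun _ _ m _ => m.size_pos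

theorem listSize_perm {l l' : List ColoredInt} (h : l.Perm l') : listSize l = listSize l' :=
  (h.map _).sum_eq

/-- A decreasing list is determined by its two complementary sublists, and any two such sublists
merge by sorting; sizes add, so generating functions multiply. -/
theorem gf_split {p r : ColoredInt → Bool} (hr : ∀ m, r m = !p m) {S T : Set (List ColoredInt)}
    (hS : ∀ l ∈ S, l.Pairwise (· ≥ ·) ∧ ∀ m ∈ l, p m)
    (hT : ∀ l ∈ T, l.Pairwise (· ≥ ·) ∧ ∀ m ∈ l, r m) :
    gf {l : List ColoredInt | l.Pairwise (· ≥ ·) ∧ l.filter p ∈ S ∧ l.filter r ∈ T} listSize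
      = gf S listSize * gf T listSize := by
  have hperm : ∀ l : List ColoredInt, (l.filter p ++ l.filter r).Perm l := by
    intro l
    rw [show r = fun m => !p m from funext hr]
    exact List.filter_append_perm p l
  have huniq : ∀ l l' : List ColoredInt, l.Pairwise (· ≥ ·) → l'.Pairwise (· ≥ ·) → l.Perm l' →
      l = l' := fun l l' h h' hp => hp.eq_of_pairwise' h h'
  rw [← gf_prod (finiteFibers_listSize S) (finiteFibers_listSize T)]
  rw [gf_of_bijOn (S := {l : List ColoredInt | l.Pairwise (· ≥ ·) ∧ l.filter p ∈ S ∧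
    l.filter r ∈ T}) (s := listSize) (fun l : List ColoredInt => (l.filter p, l.filter r))
    ⟨?_, ?_, ?_⟩ 0, pow_zero, one_mul]
  · intro l _
    rw [add_zero, ← listSize_perm (hperm l)]
    simp [listSize]
  · exact fun l hl => ⟨hl.2.1, hl.2.2⟩
  · intro l hl l' hl' h
    refine huniq l l' hl.1 hl'.1 ((hperm l).symm.trans ?_)
    have e₁ : l.filter p = l'.filter p := (Prod.ext_iff.1 h).1
    have e₂ : l.filter r = l'.filter r := (Prod.ext_iff.1 h).2
    rw [e₁, e₂]
    exact hperm l'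
  · rintro ⟨l₁, l₂⟩ ⟨h₁, h₂⟩
    have hs := List.pairwise_insertionSort (· ≥ ·) (l₁ ++ l₂)
    have hp := List.perm_insertionSort (· ≥ ·) (l₁ ++ l₂)
    have e₁ : ((l₁ ++ l₂).insertionSort (· ≥ ·)).filter p = l₁ := by
      refine huniq _ _ (hs.filter _) (hS l₁ h₁).1 ((hp.filter p).trans ?_)
      rw [List.filter_append, List.filter_eq_self.2 (hS l₁ h₁).2, List.filter_eq_nil_iff.2,
        List.append_nil]
      intro m hm
      have := (hT l₂ h₂).2 m hm
      rw [hr] at this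
      simpa using this
    have e₂ : ((l₁ ++ l₂).insertionSort (· ≥ ·)).filter r = l₂ := by
      refine huniq _ _ (hs.filter _) (hT l₂ h₂).1 ((hp.filter r).trans ?_)
      rw [List.filter_append, List.filter_eq_self.2 (hT l₂ h₂).2, List.filter_eq_nil_iff.2,
        List.nil_append]
      intro m hm
      rw [hr, (hS l₁ h₁).2 m hm]
      simp
    exact ⟨_, ⟨hs, by rw [e₁]; exact h₁, by rw [e₂]; exact h₂⟩, Prod.ext e₁ e₂⟩

/-- The decreasing lists of `r` parts in the color `c` that exceed `m` and have gaps at least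
`g`. -/
def monoLists (c : Color) (g m r : ℕ) : Set (List ColoredInt) :=
  {l | (∀ x ∈ l, x.color = c) ∧ l.Pairwise (fun x y => y.size + g ≤ x.size) ∧
    (∀ x ∈ l, m + 1 ≤ x.size) ∧ l.length = r}

theorem gf_monoLists {c : Color} {g m : ℕ} (hg : 1 ≤ g) (hm : c.minSize ≤ m + 1) (r : ℕ) :
    gf (monoLists c g m r) listSize = X ^ ((m + 1) * r + g * r.choose 2) * invPoch r := by
  rw [← gf_gapLists hg]
  rw [gf_of_bijOn (S := monoLists c g m r) (T := gapLists g m r)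
    (fun l => (l.map ColoredInt.size).reverse) ⟨?_, ?_, ?_⟩ 0, pow_zero, one_mul]
  · intro l _
    rw [List.sum_reverse]
    rfl
  · rintro l ⟨-, h1, h2, h3⟩
    refine ⟨?_, ?_, by simpa using h3⟩
    · rw [List.pairwise_reverse, List.pairwise_map]
      exact h1
    · simpa using h2
  · rintro l ⟨hl, -⟩ l' ⟨hl', -⟩ h
    replace h := List.reverse_injective h
    induction l generalizing l' with
    | nil => simpa using h.symm
    | cons x l ih =>
      obtain _ | ⟨y, l'⟩ := l'
      · simp at h
      rw [List.map_cons, List.map_cons, List.cons.injEq] at h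
      rw [List.forall_mem_cons] at hl hl'
      rw [ih hl.2 hl'.2 h.2, ColoredInt.ext (hl.1.trans hl'.1.symm) h.1]
  · rintro l ⟨h1, h2, h3⟩
    refine ⟨(l.attach.map fun x => ⟨c, x.1, hm.trans (h2 x.1 x.2)⟩).reverse, ?_, ?_⟩
    · refine ⟨?_, ?_, ?_, by simpa using h3⟩
      · intro x hx
        rw [List.mem_reverse, List.mem_map] at hx
        obtain ⟨y, -, rfl⟩ := hx
        rfl
      swap
      · intro x hx
        rw [List.mem_reverse, List.mem_map] at hx
        obtain ⟨y, -, rfl⟩ := hx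
        exact h2 y.1 y.2
      rw [List.pairwise_reverse, List.pairwise_map]
      rw [← List.attach_map_subtype_val l, List.pairwise_map] at h1
      exact h1
    · simp [List.map_reverse, List.map_map, Function.comp_def]

theorem ge_of_size_lt {x y : ColoredInt} (h : y.size < x.size) : x ≥ y :=
  le_of_lt (show y < x from Prod.Lex.toLex_lt_toLex.2 (Or.inl h))

theorem size_lt_of_color_eq {x y : ColoredInt} (h : x ≥ y) (hne : x ≠ y) (hc : x.color = y.color) :
    y.size < x.size := by
  have h' : y < x := lt_of_le_of_ne h (Ne.symm hne)
  rcases Prod.Lex.toLex_lt_toLex.1 h' with h'' | ⟨-, h''⟩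
  · exact h''
  · exact absurd h'' (by rw [hc]; exact lt_irrefl _)

/-- The decreasing lists of distinct parts whose colors are in `cs`, with color counts `ν`. -/
def distinctLists (cs : List Color) (ν : Color → ℕ) : Set (List ColoredInt) :=
  {l | l.Pairwise (· ≥ ·) ∧ l.Nodup ∧ (∀ m ∈ l, m.color ∈ cs) ∧
    ∀ c ∈ cs, l.countP (fun m => m.color = c) = ν c}

theorem mem_monoLists_one {c : Color} {r : ℕ} {l : List ColoredInt} :
    l ∈ monoLists c 1 0 r ↔
      l.Pairwise (· ≥ ·) ∧ l.Nodup ∧ (∀ m ∈ l, m.color = c) ∧ l.length = r := by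
  constructor
  · rintro ⟨h1, h2, -, h3⟩
    refine ⟨h2.imp fun h => ge_of_size_lt h, h2.imp fun h => ?_, h1, h3⟩
    rintro rfl
    omega
  · rintro ⟨h1, h2, h3, h4⟩
    refine ⟨h3, ?_, fun m _ => m.size_pos, h4⟩
    refine List.Pairwise.imp_of_mem ?_ (h1.and h2)
    intro a b ha hb hab
    exact size_lt_of_color_eq hab.1 hab.2 ((h3 a ha).trans (h3 b hb).symm)

/-- Distinctness is a condition within each color separately, so one color can be split off at a
time, with gaps at least 1. -/
theorem distinctLists_cons {c : Color} {cs : List Color} (hc : c ∉ cs) (ν : Color → ℕ) :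
    distinctLists (c :: cs) ν = {l | l.Pairwise (· ≥ ·) ∧
      l.filter (fun m => m.color = c) ∈ monoLists c 1 0 (ν c) ∧
      l.filter (fun m => m.color ≠ c) ∈ distinctLists cs ν} := by
  ext l
  have hcount : ∀ c' ∈ cs, (l.filter (fun m => m.color ≠ c)).countP (fun m => m.color = c')
      = l.countP (fun m => m.color = c') := by
    intro c' hc'
    rw [List.countP_filter]
    refine List.countP_congr fun m _ => ?_
    have : c' ≠ c := fun h => hc (h ▸ hc')
    simp only [Bool.and_eq_true, decide_eq_true_eq]
    exact ⟨fun h => h.1, fun h => ⟨h, h ▸ this⟩⟩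
  simp only [Set.mem_ofPred_eq, mem_monoLists_one]
  constructor
  · rintro ⟨h1, h2, h3, h4⟩
    refine ⟨h1, ⟨h1.filter _, h2.filter _, by simp, ?_⟩, h1.filter _, h2.filter _, ?_, ?_⟩
    · rw [← List.countP_eq_length_filter]
      exact h4 c (by simp)
    · intro m hm
      have hm' := List.mem_filter.1 hm
      have := h3 m hm'.1
      simp at this hm'
      tauto
    · intro c' hc'
      rw [hcount c' hc']
      exact h4 c' (by simp [hc'])
  · rintro ⟨h1, ⟨-, h2, -, h3⟩, -, h4, h5, h6⟩
    refine ⟨h1, ?_, ?_, ?_⟩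
    · have hp : (l.filter (fun m => m.color = c) ++ l.filter (fun m => m.color ≠ c)).Perm l := by
        have := List.filter_append_perm (fun m : ColoredInt => decide (m.color = c)) l
        simpa using this
      refine hp.nodup_iff.1 (List.nodup_append'.2 ⟨h2, h4, ?_⟩)
      intro m hm hm'
      have e1 := (List.mem_filter.1 hm).2
      have e2 := (List.mem_filter.1 hm').2
      simp at e1 e2
      exact e2 e1
    · intro m hm
      by_cases h : m.color = c
      · simp [h]
      · exact List.mem_cons_of_mem _ (h5 m (List.mem_filter.2 ⟨hm, by simpa using h⟩))
    · intro c' hc'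
      rcases List.mem_cons.1 hc' with rfl | hc'
      · rw [List.countP_eq_length_filter]
        exact h3
      · rw [← hcount c' hc']
        exact h6 c' hc'

theorem gf_distinctLists (cs : List Color) (hcs : cs.Nodup) (h1 : ∀ c ∈ cs, c.minSize = 1)
    (ν : Color → ℕ) :
    gf (distinctLists cs ν) listSize
      = (cs.map fun c => distinctTerm (X : ℚ⟦X⟧) invPoch (ν c)).prod := by
  induction cs with
  | nil =>
    have : distinctLists [] ν = {[]} := by
      ext l
      rw [Set.mem_singleton_iff]
      constructor
      · rintro ⟨-, -, h, -⟩
        exact List.eq_nil_iff_forall_not_mem.2 fun m hm => by simpa using h m hm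
      · rintro rfl
        exact ⟨by simp, by simp, by simp, by simp⟩
    rw [this, gf_singleton_nil _ rfl]
    simp
  | cons c cs ih =>
    rw [List.nodup_cons] at hcs
    rw [List.forall_mem_cons] at h1
    rw [distinctLists_cons hcs.1, gf_split, ih hcs.2 h1.2, gf_monoLists le_rfl h1.1.le,
      List.map_cons, List.prod_cons, distinctTerm]
    · rw [Nat.choose_succ_succ' (ν c) 1, Nat.choose_one_right, zero_add, one_mul, one_mul]
    · intro m
      simp
    · intro l hl
      rw [mem_monoLists_one] at hl
      exact ⟨hl.1, by simpa using hl.2.2.1⟩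
    · intro l hl
      refine ⟨hl.1, fun m hm => ?_⟩
      have := hl.2.2.1 m hm
      simp only [ne_eq, decide_not, Bool.not_eq_eq_eq_not, Bool.not_true, decide_eq_false_iff_not]
      exact fun h => hcs.1 (h ▸ this)

end Lists

end FourColor

/-! ### Non-quaternary parts, with and without the part 1 in color A. -/

namespace FourColor

open Finset PowerSeries

section TypeOne

/-- The color and the size of a colored integer. -/
def ColoredInt.toPair (m : ColoredInt) : Color × ℕ := (m.color, m.size)

theorem ColoredInt.toPair_injective : Function.Injective ColoredInt.toPair := by
  intro x y h
  exact ColoredInt.ext (Prod.ext_iff.1 h).1 (Prod.ext_iff.1 h).2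

/-- The decreasing lists of parts with color counts `ν` that satisfy the gap condition. -/
def gapConditionLists (ν : Color → ℕ) : Set (List ColoredInt) :=
  {l | l.Pairwise GapCondition ∧ ∀ x, l.countP (fun m => m.color = x) = ν x}

/-- A list of colored integers as an increasing list of pairs. -/
def pairList (l : List ColoredInt) : List (Color × ℕ) := (l.map ColoredInt.toPair).reverse

theorem partSum_pairList (l : List ColoredInt) : partSum (pairList l) = listSize l := by
  rw [partSum, pairList, List.map_reverse, List.sum_reverse, List.map_map]
  rfl

theorem pairList_injective : Function.Injective pairList := fun _ _ h =>
  ColoredInt.toPair_injective.list_map (List.reverse_injective h)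

theorem pairList_mem_chains {ν : Color → ℕ} {l : List ColoredInt} :
    pairList l ∈ chains none 0 ν ↔ l ∈ gapConditionLists ν := by
  have h1 : ∀ x, (pairList l).countP (fun y => y.1 = x) = l.countP (fun m => m.color = x) := by
    intro x
    rw [pairList, List.countP_reverse, List.countP_map]
    rfl
  constructor
  · rintro ⟨h2, -, h3⟩
    refine ⟨?_, fun x => (h1 x).symm.trans (h3 x)⟩
    rw [pairList, List.pairwise_reverse, List.pairwise_map] at h2
    exact h2
  · rintro ⟨h2, h3⟩
    refine ⟨?_, ?_, fun x => (h1 x).trans (h3 x)⟩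
    · rw [pairList, List.pairwise_reverse, List.pairwise_map]
      exact h2
    · intro y hy
      rw [pairList, List.mem_reverse, List.mem_map] at hy
      obtain ⟨m, -, rfl⟩ := hy
      exact ⟨m.size_pos, fun _ => trivial⟩

theorem exists_pairList_eq {l : List (Color × ℕ)} (h : ∀ y ∈ l, y.1.minSize ≤ y.2) :
    ∃ l', pairList l' = l := by
  refine ⟨(l.attach.map fun y => ⟨y.1.1, y.1.2, h y.1 y.2⟩).reverse, ?_⟩
  simp only [pairList, ColoredInt.toPair, List.map_reverse, List.map_map, Function.comp_def,
    List.reverse_reverse]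
  exact List.attach_map_subtype_val l

theorem color_ne_of_mem_chains {p : Option Color} {m : ℕ} {ν : Color → ℕ} {x : Color}
    (hν : ν x = 0) {l : List (Color × ℕ)} (hl : l ∈ chains p m ν) {y : Color × ℕ} (hy : y ∈ l) :
    y.1 ≠ x := by
  intro h
  have h0 := hl.2.2 x
  rw [hν, List.countP_eq_zero] at h0
  exact h0 y hy (by simpa using h)

theorem Color.minSize_le_two {x : Color} (h : x ≠ .ABCD) : x.minSize ≤ 2 := by
  cases x <;> first | exact absurd rfl h | decide

theorem Color.IsPrimary.minSize {x : Color} (h : x.IsPrimary) : x.minSize = 1 := by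
  rcases h with rfl | rfl | rfl | rfl <;> rfl

/-- Sizes at least 2 are admissible in every non-quaternary color, so the minimal sizes only
restrict parts of size 1. -/
theorem minSize_le_of_mem_chains {p : Option Color} {m : ℕ} {ν : Color → ℕ} (hν : ν .ABCD = 0)
    (hm : 1 ≤ m) {l : List (Color × ℕ)} (hl : l ∈ chains p m ν) :
    ∀ y ∈ l, y.1.minSize ≤ y.2 := by
  intro y hy
  have h1 := Color.minSize_le_two (color_ne_of_mem_chains hν hl hy)
  have h2 := (hl.2.1 y hy).1
  omega

theorem minSize_le_of_mem_chainsFrom {ν : Color → ℕ} (hν : ν .ABCD = 0) {x : Color}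
    (hx : x.IsPrimary) {l : List (Color × ℕ)} (hl : l ∈ chainsFrom none 0 ν x) :
    ∀ y ∈ l, y.1.minSize ≤ y.2 := by
  obtain ⟨-, -, l, hl, rfl⟩ := hl
  intro y hy
  rcases List.mem_cons.1 hy with rfl | hy
  · exact hx.minSize.le
  · exact minSize_le_of_mem_chains (by simp [hν]) le_rfl hl y hy

/-- Pairs whose size is too small for their color come from no `ColoredInt`; the bound on T excludes
them. -/
theorem bijOn_pairList {S : Set (List ColoredInt)} {T : Set (List (Color × ℕ))}
    (h : ∀ l, pairList l ∈ T ↔ l ∈ S) (hT : ∀ l ∈ T, ∀ y ∈ l, y.1.minSize ≤ y.2) :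
    Set.BijOn pairList S T := by
  refine ⟨fun l hl => (h l).2 hl, pairList_injective.injOn, fun l hl => ?_⟩
  obtain ⟨l', rfl⟩ := exists_pairList_eq (hT l hl)
  exact ⟨l', (h l').1 hl, rfl⟩

/-- All parts but the smallest exceed 1, so `A₁` can only be the smallest part. -/
theorem mem_chainsFrom_A {ν : Color → ℕ} {l : List ColoredInt} :
    pairList l ∈ chainsFrom none 0 ν .A ↔ l ∈ gapConditionLists ν ∧ A₁ ∈ l := by
  have hA : A₁ ∈ l ↔ (Color.A, 1) ∈ pairList l := by
    rw [pairList, List.mem_reverse, List.mem_map]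
    constructor
    · exact fun h => ⟨A₁, h, rfl⟩
    · rintro ⟨m, hm, h⟩
      rwa [← ColoredInt.toPair_injective (a₁ := m) (a₂ := A₁) h]
  rw [hA, ← pairList_mem_chains]
  constructor
  · intro h
    refine ⟨chainsFrom_subset _ _ _ _ h, ?_⟩
    obtain ⟨-, -, l', -, h⟩ := h
    rw [← h]
    simp
  · rintro ⟨h, hm⟩
    rw [chains_eq, Set.mem_union, Set.mem_iUnion] at h
    rcases h with h | ⟨x, hx⟩
    · have := (h.2.1 _ hm).1
      simp at this
    · have hx' := hx
      obtain ⟨-, -, l', hl', h⟩ := hx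
      rw [← h, List.mem_cons] at hm
      rcases hm with hm | hm
      · cases hm
        exact hx'
      · have := (hl'.2.1 _ hm).1
        simp at this

theorem gf_chainsFrom_eq {m : ℕ} {ν : Color → ℕ} (hν : ν .ABCD = 0) (x : Color) :
    gf (chainsFrom none m ν x) partSum
      = X ^ (m * ∑ x, ν x + quadExp ν + countBelow ν x) * (1 - X ^ ν x)
        * ∏ x, invPoch (ν x) := by
  rw [gf_chainsFrom]
  by_cases hx : ν x = 0
  · simp [hx]
  · rw [if_pos ⟨trivial, hx⟩, gf_chains _ _ (by simp [hν]), chainSeries_sub_single hν hx]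

theorem gf_with_A₁ {ν : Color → ℕ} (hν : ν .ABCD = 0) :
    gf {l | l ∈ gapConditionLists ν ∧ A₁ ∈ l} listSize
      = X ^ quadExp ν * (X ^ countBelow ν .A * (1 - X ^ ν .A)) * ∏ x, invPoch (ν x) := by
  have h := gf_of_bijOn (S := {l | l ∈ gapConditionLists ν ∧ A₁ ∈ l}) pairList
    (bijOn_pairList (fun l => mem_chainsFrom_A)
      fun l => minSize_le_of_mem_chainsFrom hν (Or.inl rfl)) (s := listSize) (t := partSum) 0
    fun l _ => partSum_pairList l
  rw [pow_zero, one_mul, gf_chainsFrom_eq hν] at h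
  rw [← h]
  ring

/-- Either all parts are at least 2, or the smallest is 1 in a primary color. C and D are adjacent
at the top of the order, so their terms telescope with X^(total count), leaving X^(countBelow C);
secondary colors separate A from B and B from C, which leaves those terms in place. -/
theorem gf_gapConditionLists {ν : Color → ℕ} (hν : ν .ABCD = 0) :
    gf (gapConditionLists ν) listSize
      = X ^ quadExp ν * (X ^ countBelow ν .A * (1 - X ^ ν .A)
        + X ^ countBelow ν .B * (1 - X ^ ν .B) + X ^ countBelow ν .C)
        * ∏ x, invPoch (ν x) := by
  let T : Set (List (Color × ℕ)) :=
    chains none 1 ν ∪ ⋃ x, {l | x.IsPrimary ∧ l ∈ chainsFrom none 0 ν x}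
  have hT : ∀ l ∈ T, ∀ y ∈ l, y.1.minSize ≤ y.2 := by
    rintro l (hl | hl)
    · exact minSize_le_of_mem_chains hν le_rfl hl
    · rw [Set.mem_iUnion] at hl
      obtain ⟨x, hx, hl⟩ := hl
      exact minSize_le_of_mem_chainsFrom hν hx hl
  have hmem : ∀ l, pairList l ∈ T ↔ l ∈ gapConditionLists ν := by
    intro l
    rw [← pairList_mem_chains, chains_eq, Set.mem_union, Set.mem_union, Set.mem_iUnion,
      Set.mem_iUnion]
    refine or_congr Iff.rfl (exists_congr fun x => ⟨fun h => h.2, fun h => ⟨?_, h⟩⟩)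
    have hx : x ≠ .ABCD := fun hx => h.2.1 (hx ▸ hν)
    obtain ⟨-, -, l', -, h⟩ := h
    have hm : (x, 1) ∈ pairList l := by rw [← h]; simp
    rw [pairList, List.mem_reverse, List.mem_map] at hm
    obtain ⟨m, -, h1⟩ := hm
    have h2 := m.minSize_le
    rw [show m.color = x from congrArg Prod.fst h1, show m.size = 1 from congrArg Prod.snd h1]
      at h2
    revert h2
    cases x <;> decide
  have h := gf_of_bijOn pairList (bijOn_pairList hmem hT) (s := listSize)
    (t := partSum) 0 fun l _ => partSum_pairList l
  have hsub : ∀ x, {l | x.IsPrimary ∧ l ∈ chainsFrom none 0 ν x} ⊆ chains none 0 ν :=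
    fun x l hl => chainsFrom_subset _ _ _ _ hl.2
  have hfin := chains_finiteFibers none 0 ν
  have hgf : ∀ x, gf {l | x.IsPrimary ∧ l ∈ chainsFrom none 0 ν x} partSum
      = if x.IsPrimary then gf (chainsFrom none 0 ν x) partSum else 0 := by
    intro x
    split_ifs with hx
    · simp only [hx, true_and, Set.ofPred_mem_eq]
    · simp only [hx, false_and]
      exact gf_empty _
  rw [pow_zero, one_mul, gf_union (chains_finiteFibers _ _ _),
    gf_iUnion fun x => hfin.subset (hsub x), gf_chains _ _ hν] at h
  rotate_left
  · intro x y hxy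
    rw [Set.disjoint_left]
    rintro _ ⟨-, -, -, l, -, rfl⟩ ⟨-, -, -, l', -, h⟩
    cases h
    exact hxy rfl
  · exact hfin.subset (Set.iUnion_subset hsub)
  · rw [Set.disjoint_iUnion_right]
    intro x
    rw [Set.disjoint_left]
    rintro _ ⟨-, h, -⟩ ⟨-, -, -, l, -, rfl⟩
    have := (h (x, 1) (by simp)).1
    simp at this
  have hC : countBelow ν .D = countBelow ν .C + ν .C := by
    simp [countBelow, Color.sum_univ, Color.rank]
  have hD : ∑ x, ν x = countBelow ν .C + ν .C + ν .D := by
    simp [countBelow, Color.sum_univ, Color.rank]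
  have h3 : countForbidden ν none = 0 := by simp [countForbidden, Allowed]
  rw [← h, sum_congr rfl fun x _ => hgf x, Color.sum_univ (fun x => ite _ _ _)]
  simp only [Color.IsPrimary, reduceCtorEq, or_self, or_true, true_or, if_true, if_false,
    gf_chainsFrom_eq hν, chainSeries, h3, hC]
  rw [hD]
  ring

theorem gf_without_A₁ {ν : Color → ℕ} (hν : ν .ABCD = 0) :
    gf {l | l ∈ gapConditionLists ν ∧ A₁ ∉ l} listSize
      = X ^ quadExp ν * (X ^ countBelow ν .B * (1 - X ^ ν .B) + X ^ countBelow ν .C)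
        * ∏ x, invPoch (ν x) := by
  have h : gapConditionLists ν = {l | l ∈ gapConditionLists ν ∧ A₁ ∈ l}
      ∪ {l | l ∈ gapConditionLists ν ∧ A₁ ∉ l} := by
    ext l
    simp only [Set.mem_union, Set.mem_ofPred_eq]
    tauto
  have h1 := gf_gapConditionLists hν
  rw [h, gf_union (finiteFibers_listSize _) (finiteFibers_listSize _), gf_with_A₁ hν] at h1
  · linear_combination h1
  · rw [Set.disjoint_left]
    exact fun l h1 h2 => h2.2 h1.2

end TypeOne

end FourColor

/-! ### Generating function of Type-1 partitions and conclusion. -/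

namespace FourColor

open Finset PowerSeries

section Main

theorem card_coloredPartition (n : ℕ) (p : List ColoredInt → Prop) :
    (Nat.card {x : ColoredPartition n // p x.parts} : ℚ)
      = coeff n (gf {l : List ColoredInt | l.Pairwise (· ≥ ·) ∧ p l} listSize) := by
  rw [coeff_gf, ← Nat.card_coe_set_eq]
  refine congrArg _ (Nat.card_congr ?_)
  exact
    { toFun := fun x => ⟨x.1.parts, ⟨x.1.sorted, x.2⟩, x.1.sum_eq⟩
      invFun := fun l => ⟨⟨l.1, l.2.1.1, l.2.2⟩, l.2.1.2⟩
      left_inv := fun _ => rfl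
      right_inv := fun _ => rfl }

theorem length_eq_sum_countP (l : List ColoredInt) :
    l.length = ∑ x, l.countP (fun m => m.color = x) := by
  induction l with
  | nil => simp
  | cons m l ih => simp [List.countP_cons, sum_add_distrib, ← ih]

theorem length_eq_sum_of_countP_eq {l : List ColoredInt} {μ : Color → ℕ}
    (h : ∀ x, l.countP (fun m => m.color = x) = μ x) : l.length = ∑ x, μ x := by
  rw [length_eq_sum_countP, sum_congr rfl fun x _ => h x]

/-- The conditions on the parts of a Type-1 partition with color counts `ν`. -/
def TypeOneParts (ν : Color → ℕ) (l : List ColoredInt) : Prop :=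
  (l.filter (fun m => m.color ≠ .ABCD)).Pairwise GapCondition ∧
  (l.filter (fun m => m.color = .ABCD)).Pairwise (fun x y => y.size + 4 ≤ x.size) ∧
  (∀ m ∈ l.filter (fun m => m.color = .ABCD),
    (if A₁ ∈ l then 3 + 2 * (l.filter (fun m => m.color ≠ .ABCD)).length
      else 4 + 2 * (l.filter (fun m => m.color ≠ .ABCD)).length) ≤ m.size) ∧
  ∀ x, l.countP (fun m => m.color = x) = ν x

theorem tildeG_eq (n : ℕ) (ν : Color → ℕ) :
    (tildeG n ν : ℚ)
      = coeff n (gf {l : List ColoredInt | l.Pairwise (· ≥ ·) ∧ TypeOneParts ν l} listSize) := by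
  rw [← card_coloredPartition, tildeG]
  refine congrArg _ (Nat.card_congr (Equiv.subtypeEquivRight fun p => ?_))
  exact ⟨fun h => ⟨h.1.gap, h.1.gap_quaternary, h.1.lower, h.2⟩,
    fun h => ⟨⟨h.1, h.2.1, h.2.2.1⟩, h.2.2.2⟩⟩

/-- The color counts of the non-quaternary parts. -/
def nonquaternaryCount (ν : Color → ℕ) : Color → ℕ := Function.update ν .ABCD 0

theorem countP_iff (ν : Color → ℕ) (l : List ColoredInt) :
    (∀ x, l.countP (fun m => m.color = x) = ν x) ↔
      (∀ x, (l.filter (fun m => m.color ≠ .ABCD)).countP (fun m => m.color = x)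
        = nonquaternaryCount ν x) ∧ (l.filter (fun m => m.color = .ABCD)).length = ν .ABCD := by
  have h1 : ∀ x, x ≠ Color.ABCD →
      (l.filter (fun m => m.color ≠ .ABCD)).countP (fun m => m.color = x)
        = l.countP (fun m => m.color = x) := by
    intro x hx
    rw [List.countP_filter]
    refine List.countP_congr fun m _ => ?_
    simp only [Bool.and_eq_true, decide_eq_true_eq]
    exact ⟨fun h => h.1, fun h => ⟨h, h ▸ hx⟩⟩
  have h2 : (l.filter (fun m => m.color ≠ .ABCD)).countP (fun m => m.color = Color.ABCD) = 0 := by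
    rw [List.countP_eq_zero]
    intro m hm
    simpa using (List.mem_filter.1 hm).2
  rw [← List.countP_eq_length_filter]
  constructor
  · refine fun h => ⟨fun x => ?_, h _⟩
    by_cases hx : x = .ABCD
    · subst hx
      rw [h2]
      simp [nonquaternaryCount]
    · rw [h1 x hx, h x]
      simp [nonquaternaryCount, hx]
  · rintro ⟨h, h'⟩ x
    by_cases hx : x = .ABCD
    · subst hx
      exact h'
    · rw [← h1 x hx, h x]
      simp [nonquaternaryCount, hx]

theorem GapCondition.ge {x y : ColoredInt} (h : GapCondition x y) : x ≥ y := ge_of_size_lt h.1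

/-- Since τ is determined by ν, the bound on the quaternary parts depends only on whether `A₁`
occurs. In each of the two cases the quaternary and non-quaternary parts are independent. -/
theorem setOf_typeOneParts (ν : Color → ℕ) :
    {l : List ColoredInt | l.Pairwise (· ≥ ·) ∧ TypeOneParts ν l}
      = {l : List ColoredInt | l.Pairwise (· ≥ ·) ∧
          l.filter (fun m => m.color ≠ .ABCD)
            ∈ {l | l ∈ gapConditionLists (nonquaternaryCount ν) ∧ A₁ ∈ l} ∧
          l.filter (fun m => m.color = .ABCD)
            ∈ monoLists .ABCD 4 (2 + 2 * ∑ x, nonquaternaryCount ν x) (ν .ABCD)}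
        ∪ {l : List ColoredInt | l.Pairwise (· ≥ ·) ∧
          l.filter (fun m => m.color ≠ .ABCD)
            ∈ {l | l ∈ gapConditionLists (nonquaternaryCount ν) ∧ A₁ ∉ l} ∧
          l.filter (fun m => m.color = .ABCD)
            ∈ monoLists .ABCD 4 (3 + 2 * ∑ x, nonquaternaryCount ν x) (ν .ABCD)} := by
  ext l
  have hA : A₁ ∈ l.filter (fun m => m.color ≠ .ABCD) ↔ A₁ ∈ l := by
    rw [List.mem_filter]
    exact ⟨fun h => h.1, fun h => ⟨h, rfl⟩⟩
  have hc : ∀ m ∈ l.filter (fun m => m.color = .ABCD), m.color = .ABCD := by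
    intro m hm
    simpa using (List.mem_filter.1 hm).2
  simp only [Set.mem_union, Set.mem_ofPred_eq, hA]
  constructor
  · rintro ⟨h1, h2, h3, h4, h5⟩
    obtain ⟨h6, h7⟩ := (countP_iff ν l).1 h5
    rw [length_eq_sum_of_countP_eq h6] at h4
    by_cases h : A₁ ∈ l
    · refine Or.inl ⟨h1, ⟨⟨h2, h6⟩, h⟩, hc, h3, fun m hm => ?_, h7⟩
      have := h4 m hm
      rw [if_pos h] at this
      omega
    · refine Or.inr ⟨h1, ⟨⟨h2, h6⟩, h⟩, hc, h3, fun m hm => ?_, h7⟩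
      have := h4 m hm
      rw [if_neg h] at this
      omega
  · rintro (⟨h1, ⟨⟨h2, h6⟩, h⟩, -, h3, h4, h7⟩ | ⟨h1, ⟨⟨h2, h6⟩, h⟩, -, h3, h4, h7⟩) <;>
    · refine ⟨h1, h2, h3, fun m hm => ?_, (countP_iff ν l).2 ⟨h6, h7⟩⟩
      rw [length_eq_sum_of_countP_eq h6]
      have := h4 m hm
      simp only [h, if_true, if_false]
      omega

/-- The added term is the least sum of n quaternary parts above t other parts: a first part 3 + 2t
and gaps 4. This explains the weight 2 of quaternary parts in `weightedLength`. -/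
theorem choose_two_add (t n : ℕ) :
    (t + 2 * n + 1).choose 2 = (t + 1).choose 2 + ((3 + 2 * t) * n + 4 * n.choose 2) := by
  have h1 : ∀ n : ℕ, (n + 1).choose 2 = n + n.choose 2 := fun n => by
    rw [Nat.choose_succ_succ' n 1, Nat.choose_one_right]
  induction n with
  | zero => simp
  | succ n ih =>
    rw [show t + 2 * (n + 1) + 1 = t + 2 * n + 1 + 1 + 1 by ring, h1 (t + 2 * n + 1 + 1),
      h1 (t + 2 * n + 1), ih, h1 n]
    ring

theorem quadExp_eq (ν : Color → ℕ) :
    quadExp ν = quadExp (nonquaternaryCount ν)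
      + ((3 + 2 * ∑ x, nonquaternaryCount ν x) * ν .ABCD + 4 * (ν .ABCD).choose 2) := by
  have h : weightedLength ν = ∑ x, nonquaternaryCount ν x + 2 * ν .ABCD := by
    simp [weightedLength, Color.sum_univ, nonquaternaryCount]
  have h' : weightedLength (nonquaternaryCount ν) = ∑ x, nonquaternaryCount ν x := by
    simp [weightedLength, Color.sum_univ, nonquaternaryCount]
  rw [quadExp, quadExp, h, h', choose_two_add]
  simp only [nonquaternaryCount, Function.update, reduceCtorEq, dite_false, eq_rec_constant]
  ring

theorem prod_invPoch_eq (ν : Color → ℕ) :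
    ∏ x, invPoch (ν x) = invPoch (ν .ABCD) * ∏ x, invPoch (nonquaternaryCount ν x) := by
  rw [← mul_prod_erase univ _ (mem_univ Color.ABCD),
    ← mul_prod_erase univ (fun x => invPoch (nonquaternaryCount ν x)) (mem_univ Color.ABCD)]
  have h : ∏ x ∈ univ.erase .ABCD, invPoch (nonquaternaryCount ν x)
      = ∏ x ∈ univ.erase .ABCD, invPoch (ν x) :=
    prod_congr rfl fun x hx => by simp [nonquaternaryCount, ne_of_mem_erase hx]
  rw [h]
  simp [nonquaternaryCount, invPoch_zero]

/-- Without `A₁` the bound on the quaternary parts is larger by one, which costs one extra X per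
quaternary part; hence ν ABCD in the last two exponents only. -/
theorem gf_typeOneParts (ν : Color → ℕ) :
    gf {l : List ColoredInt | l.Pairwise (· ≥ ·) ∧ TypeOneParts ν l} listSize
      = X ^ quadExp ν * (X ^ (ν .AB + ν .AC + ν .AD) * (1 - X ^ ν .A)
        + X ^ (ν .AB + ν .AC + ν .AD + ν .A + ν .BC + ν .BD + ν .ABCD) * (1 - X ^ ν .B)
        + X ^ (ν .AB + ν .AC + ν .AD + ν .A + ν .BC + ν .BD + ν .B + ν .CD + ν .ABCD))
        * ∏ x, invPoch (ν x) := by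
  have hν : nonquaternaryCount ν .ABCD = 0 := by simp [nonquaternaryCount]
  have hne : ∀ m : ColoredInt, decide (m.color = .ABCD) = !decide (m.color ≠ .ABCD) := by simp
  have hS : ∀ l ∈ gapConditionLists (nonquaternaryCount ν),
      l.Pairwise (· ≥ ·) ∧ ∀ m ∈ l, decide (m.color ≠ .ABCD) = true := by
    intro l hl
    refine ⟨hl.1.imp fun h => h.ge, fun m hm => ?_⟩
    have h0 := hl.2 .ABCD
    rw [hν, List.countP_eq_zero] at h0
    simpa using h0 m hm
  have hT : ∀ t, ∀ l ∈ monoLists .ABCD 4 t (ν .ABCD),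
      l.Pairwise (· ≥ ·) ∧ ∀ m ∈ l, decide (m.color = .ABCD) = true :=
    fun t l hl => ⟨hl.2.1.imp fun h => ge_of_size_lt (by omega), by simpa using hl.1⟩
  have hprod := prod_invPoch_eq ν
  have hmin : ∀ {t : ℕ}, 4 ≤ t → Color.ABCD.minSize ≤ t := fun h => h
  rw [setOf_typeOneParts, gf_union (finiteFibers_listSize _) (finiteFibers_listSize _)]
  swap
  · rw [Set.disjoint_left]
    exact fun l h1 h2 => h2.2.1.2 h1.2.1.2
  rw [gf_split hne (fun l hl => hS l hl.1) (hT _), gf_split hne (fun l hl => hS l hl.1) (hT _),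
    gf_with_A₁ hν, gf_without_A₁ hν,
    gf_monoLists (m := 3 + 2 * ∑ x, nonquaternaryCount ν x) (by norm_num) (hmin (by omega))]
  have hA : X ^ quadExp (nonquaternaryCount ν) * (X ^ countBelow (nonquaternaryCount ν) .A
        * (1 - X ^ nonquaternaryCount ν .A)) * (∏ x, invPoch (nonquaternaryCount ν x))
        * gf (monoLists .ABCD 4 (2 + 2 * ∑ x, nonquaternaryCount ν x) (ν .ABCD)) listSize
      = X ^ quadExp (nonquaternaryCount ν) * (X ^ countBelow (nonquaternaryCount ν) .A
        * (1 - X ^ nonquaternaryCount ν .A)) * (∏ x, invPoch (nonquaternaryCount ν x))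
        * (X ^ ((2 + 2 * ∑ x, nonquaternaryCount ν x + 1) * ν .ABCD
          + 4 * (ν .ABCD).choose 2) * invPoch (ν .ABCD)) := by
    -- The bound 3 + 2τ is at least the minimal quaternary size 4 only if τ ≥ 1. A part in color A
    -- guarantees this; if there is none, the factor 1 - X^0 makes both sides zero.
    by_cases h0 : nonquaternaryCount ν .A = 0
    · simp [h0]
    · have h1 : nonquaternaryCount ν .A ≤ ∑ x, nonquaternaryCount ν x :=
        single_le_sum (fun _ _ => Nat.zero_le _) (mem_univ _)
      rw [gf_monoLists (by norm_num) (hmin (by omega))]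
  rw [hA, hprod, quadExp_eq ν]
  have e1 : countBelow (nonquaternaryCount ν) .A = ν .AB + ν .AC + ν .AD := by
    simp [countBelow, Color.sum_univ, Color.rank, nonquaternaryCount]
  have e2 : countBelow (nonquaternaryCount ν) .B
      = ν .AB + ν .AC + ν .AD + ν .A + ν .BC + ν .BD := by
    simp [countBelow, Color.sum_univ, Color.rank, nonquaternaryCount]
  have e3 : countBelow (nonquaternaryCount ν) .C
      = ν .AB + ν .AC + ν .AD + ν .A + ν .BC + ν .BD + ν .B + ν .CD := by
    simp [countBelow, Color.sum_univ, Color.rank, nonquaternaryCount]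
  have e4 : nonquaternaryCount ν .A = ν .A := by simp [nonquaternaryCount]
  have e5 : nonquaternaryCount ν .B = ν .B := by simp [nonquaternaryCount]
  rw [e1, e2, e3, e4, e5]
  ring

theorem mem_letterFinset_iff {i j k l : ℕ} {ν : Color → ℕ} :
    ν ∈ letterFinset ![i, j, k, l] ![0, 0, 0, 0] ↔ Constraints i j k l ν := by
  rw [mem_letterFinset]
  simp only [Fin.forall_fin_succ, Color.sum_univ, Color.letters, Constraints]
  simp
  constructor
  · rintro ⟨h1, h2, h3, h4⟩
    exact ⟨by omega, by omega, by omega, by omega⟩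
  · rintro ⟨h1, h2, h3, h4⟩
    exact ⟨by omega, by omega, by omega, by omega⟩

theorem sum_gf_typeOneParts (i j k l : ℕ) :
    ∑ ν ∈ letterFinset ![i, j, k, l] ![0, 0, 0, 0],
        gf {l : List ColoredInt | l.Pairwise (· ≥ ·) ∧ TypeOneParts ν l} listSize
      = fullSum X invPoch ![i, j, k, l] := by
  rw [fullSum, ← typeOne_sum_eq _ invPoch_succ]
  simp only [litSum, colorSum, ← sum_sub_distrib, ← sum_add_distrib]
  refine sum_congr rfl fun ν _ => ?_
  rw [gf_typeOneParts]
  simp only [Color.sum_univ, colorVec, one_mul, zero_mul, add_zero, zero_add]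
  ring

theorem P_eq (n i j k l : ℕ) :
    (P n i j k l : ℚ) = coeff n (distinctTerm X invPoch i * distinctTerm X invPoch j
      * distinctTerm X invPoch k * distinctTerm X invPoch l) := by
  -- The value 0 on the other colors plays no role, since `distinctLists` only reads the counts of
  -- the listed colors.
  let ν : Color → ℕ := fun | .A => i | .B => j | .C => k | .D => l | _ => 0
  have h := gf_distinctLists [.A, .B, .C, .D] (by decide)
    (by intro c hc; fin_cases hc <;> rfl) ν
  simp only [List.map_cons, List.map_nil, List.prod_cons, List.prod_nil, mul_one] at h
  rw [mul_assoc, mul_assoc, show distinctTerm X invPoch i * (distinctTerm X invPoch j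
    * (distinctTerm X invPoch k * distinctTerm X invPoch l)) = _ from h.symm, P]
  rw [show (distinctLists [.A, .B, .C, .D] ν) = {l : List ColoredInt | l.Pairwise (· ≥ ·) ∧
    (l.Nodup ∧ (∀ m ∈ l, m.color ∈ [Color.A, .B, .C, .D]) ∧
    ∀ c ∈ [Color.A, .B, .C, .D], l.countP (fun m => m.color = c) = ν c)} from rfl,
    ← card_coloredPartition]
  refine congrArg _ (Nat.card_congr (Equiv.subtypeEquivRight fun p => ?_))
  simp [ColoredPartition.count, Color.IsPrimary, ν]

end Main

end FourColor

theorem theorem6 (n i j k l : ℕ) :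
    FourColor.G n i j k l = FourColor.P n i j k l := by
  rw [← Nat.cast_inj (R := ℚ), FourColor.P_eq, FourColor.G, Nat.cast_sum,
    ← FourColor.fullSum_eq FourColor.one_sub_X_pow_ne_zero FourColor.invPoch_zero
      FourColor.invPoch_succ, ← FourColor.sum_gf_typeOneParts, map_sum]
  refine Finset.sum_congr ?_ fun ν _ => FourColor.tildeG_eq n ν
  ext ν
  rw [FourColor.mem_letterFinset_iff, Set.Finite.mem_toFinset]
  rfl
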